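/- Let $\mathbb H=\mathbb R^3$ be the Heisenberg group with product $(p,q,t)(p',q',t')=(p+p',q+q',t+t'+(pq'-qp')/2)$ and Lebesgue measure as Haar measure, let $(\lambda(x)f)(y)=f(x^{-1}y)$ be the left regular representation on $\mathrm L^2(\mathbb H)$, and let $\Gamma_1<\mathbb H$ be the lattice generated by $(1,0,0)$, $(0,1,0)$ and $(0,0,1)$. Write $\mathrm{sinc}(x)=\frac{\sin(\pi x)}{\pi x}$ for $x\neq 0$ and $\mathrm{sinc}(0)=1$. Let $$S(p,q,t)=\begin{cases}0 & \text{for } |p|>1,\\[2pt] \frac14\Big[\big(\frac tq+\frac{1-|p|}2\big)\,\mathrm{sinc}^2\big(\frac t2+\frac{1-|p|}4q\big)-\big(\frac tq-\frac{1-|p|}2\big)\,\mathrm{sinc}^2\big(\frac t2-\frac{1-|p|}4q\big)\Big] & \text{for } |p|\le 1,\ q\neq 0,\\[2pt] \frac{1-|p|}4\big(2\,\mathrm{sinc}(t)-\mathrm{sinc}^2(t/2)\big) & \text{for } |p|\le 1,\ q=0.\end{cases}$$ **Theorem 8.1.** The function $S$ is continuous and belongs to $\mathrm L^2(\mathbb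 H)$. Let $\mathcal H\subset\mathrm L^2(\mathbb H)$ be the left-invariant closed subspace generated by $S$, i.e. the closed linear span of $\{\lambda(x)S: x\in\mathbb H\}$. Then $\mathcal H$ is a sampling space for $\Gamma_1$ with constant $c_{\mathcal H}=1$ and sinc-type function $S$. That is, $\mathcal H$ is a left-invariant closed subspace consisting of continuous functions (every class in $\mathcal H$ has a continuous representative, with which it is identified), and for every $f\in\mathcal H$ $$\sum_{\gamma\in\Gamma_1}|f(\gamma)|^2=\|f\|_2^2 \qquad\text{and}\qquad f(x)=\sum_{\gamma\in\Gamma_1}f(\gamma)\,S(\gamma^{-1}x),$$ where the second sum converges both in $\mathrm L^2$ and uniformly on $\mathbb H$. Moreover $\lambda(\Gamma_1)S=(\lambda(\gamma)S)_{\gamma\in\Gamma_1}$ is a normalised tight frame of $\mathcal H$, i.e. $\sum_{\gamma\in\Gamma_1}|\langle f,\lambda(\gamma)S\rangle|^2=\|f\|_2^2$ for all $f\in\mathcal H$, but it is not an orthonormal basis of $\mathcal H$; indeed $\|S\|_2=\frac12$. -/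

import Mathlib

open MeasureTheory Filter Topology

noncomputable section

/-! ### The left regular representation, sampling spaces and tight frames -/

section General

variable {G : Type*} [Group G] [TopologicalSpace G] [IsTopologicalGroup G]
  [MeasurableSpace G] [BorelSpace G]

/-- The left regular representation on `L²(G)`: `(λ(x) f)(y) = f (x⁻¹ y)`. -/
def leftRegular (μ : Measure G) [μ.IsHaarMeasure] (x : G) (f : Lp ℂ 2 μ) : Lp ℂ 2 μ :=
  Lp.compMeasurePreserving (fun y => x⁻¹ * y) (measurePreserving_mul_left μ x⁻¹) f

/-- A subspace of `L²(G)` that is stable under all left translations. -/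
def IsLeftInvariant (μ : Measure G) [μ.IsHaarMeasure] (H : Submodule ℂ (Lp ℂ 2 μ)) : Prop :=
  ∀ x : G, ∀ f ∈ H, leftRegular μ x f ∈ H

/-- The left-invariant closed subspace generated by `f`: the closed linear span of the orbit
of `f` under left translations. -/
def leftInvariantClosedSpan (μ : Measure G) [μ.IsHaarMeasure] (f : Lp ℂ 2 μ) :
    Submodule ℂ (Lp ℂ 2 μ) :=
  (Submodule.span ℂ (Set.range fun x : G => leftRegular μ x f)).topologicalClosure

/-- Property (i) of a sampling space, with constant `c`: every (continuous) `f ∈ H` satisfies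
`∑_{γ ∈ Γ} |f(γ)|² = c ‖f‖₂²`. -/
def IsSamplingConstant (μ : Measure G) (Γ : Set G) (H : Submodule ℂ (Lp ℂ 2 μ)) (c : ℝ) :
    Prop :=
  0 < c ∧ ∀ f : G → ℂ, Continuous f → ∀ hf : MemLp f 2 μ, hf.toLp f ∈ H →
    HasSum (fun γ : Γ => ‖f γ‖ ^ 2) (c * ‖hf.toLp f‖ ^ 2)

/-- Property (ii) of a sampling space: `S` is a (continuous) element of `H`, and every
(continuous) `f ∈ H` has the expansion `f(x) = ∑_{γ ∈ Γ} f(γ) S(γ⁻¹ x)`, with convergence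
both in `L²` and uniformly. -/
structure IsSincTypeFunction (μ : Measure G) [μ.IsHaarMeasure] (Γ : Set G)
    (H : Submodule ℂ (Lp ℂ 2 μ)) (S : G → ℂ) : Prop where
  continuous : Continuous S
  memLp : MemLp S 2 μ
  mem : memLp.toLp S ∈ H
  hasSum_L2 : ∀ f : G → ℂ, Continuous f → ∀ hf : MemLp f 2 μ, hf.toLp f ∈ H →
    HasSum (fun γ : Γ => f γ • leftRegular μ (γ : G) (memLp.toLp S)) (hf.toLp f)
  tendstoUniformly : ∀ f : G → ℂ, Continuous f → ∀ hf : MemLp f 2 μ, hf.toLp f ∈ H →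
    TendstoUniformly (fun (F : Finset Γ) (x : G) => ∑ γ ∈ F, f γ * S ((γ : G)⁻¹ * x)) f atTop

/-- Sampling spaces with respect to `Γ`. An element of `L²(G)` is a continuous function if its
class has a continuous representative (unique, as Haar measure charges nonempty open sets). -/
structure IsSamplingSpace (μ : Measure G) [μ.IsHaarMeasure] (Γ : Set G)
    (H : Submodule ℂ (Lp ℂ 2 μ)) : Prop where
  isClosed : IsClosed (H : Set (Lp ℂ 2 μ))
  leftInvariant : IsLeftInvariant μ H
  exists_continuous : ∀ φ ∈ H, ∃ f : G → ℂ, Continuous f ∧ φ =ᵐ[μ] f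
  exists_constant : ∃ c : ℝ, IsSamplingConstant μ Γ H c
  exists_sincType : ∃ S : G → ℂ, IsSincTypeFunction μ Γ H S

end General

/-- The family `η` is a tight frame of the subspace `H` with frame constant `c`: the coefficient
operator `φ ↦ (⟨φ, η i⟩)_i` satisfies `∑ |⟨φ, η i⟩|² = c ‖φ‖²` on `H`. -/
structure IsTightFrameOf {E ι : Type*} [NormedAddCommGroup E] [InnerProductSpace ℂ E]
    (H : Submodule ℂ E) (η : ι → E) (c : ℝ) : Prop where
  pos : 0 < c
  mem : ∀ i, η i ∈ H
  hasSum : ∀ φ ∈ H, HasSum (fun i => ‖inner ℂ (η i) φ‖ ^ 2) (c * ‖φ‖ ^ 2)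

/-- The family `η` is an orthonormal basis of the subspace `H`. -/
def IsOrthonormalBasisOf {E ι : Type*} [NormedAddCommGroup E] [InnerProductSpace ℂ E]
    (H : Submodule ℂ E) (η : ι → E) : Prop :=
  ∃ b : HilbertBasis ι ℂ H, ∀ i, (b i : E) = η i

/-! ### The Heisenberg group -/

/-- The underlying space `ℝ³` of the Heisenberg group, with coordinates `(p, q, t)`. -/
def Heisenberg : Type := ℝ × ℝ × ℝ

namespace Heisenberg

/-- The element with coordinates `(p, q, t)`. -/
def mk (p q t : ℝ) : Heisenberg := (p, q, t)

/-- The first coordinate. -/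
def p (x : Heisenberg) : ℝ := Prod.fst x

/-- The second coordinate. -/
def q (x : Heisenberg) : ℝ := Prod.fst (Prod.snd x)

/-- The third (central) coordinate. -/
def t (x : Heisenberg) : ℝ := Prod.snd (Prod.snd x)

theorem ext_coord {x y : Heisenberg} (hp : x.p = y.p) (hq : x.q = y.q) (ht : x.t = y.t) :
    x = y :=
  Prod.ext hp (Prod.ext hq ht)

/-- The product `(p,q,t)(p',q',t') = (p+p', q+q', t+t'+(pq'-qp')/2)`. -/
instance : Mul Heisenberg :=
  ⟨fun x y => mk (x.p + y.p) (x.q + y.q) (x.t + y.t + (x.p * y.q - x.q * y.p) / 2)⟩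

instance : One Heisenberg := ⟨mk 0 0 0⟩

instance : Inv Heisenberg := ⟨fun x => mk (-x.p) (-x.q) (-x.t)⟩

@[simp] theorem p_mk (a b c : ℝ) : (mk a b c).p = a := rfl
@[simp] theorem q_mk (a b c : ℝ) : (mk a b c).q = b := rfl
@[simp] theorem t_mk (a b c : ℝ) : (mk a b c).t = c := rfl
@[simp] theorem p_mul (x y : Heisenberg) : (x * y).p = x.p + y.p := rfl
@[simp] theorem q_mul (x y : Heisenberg) : (x * y).q = x.q + y.q := rfl
@[simp] theorem t_mul (x y : Heisenberg) :
    (x * y).t = x.t + y.t + (x.p * y.q - x.q * y.p) / 2 := rfl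
@[simp] theorem p_one : (1 : Heisenberg).p = 0 := rfl
@[simp] theorem q_one : (1 : Heisenberg).q = 0 := rfl
@[simp] theorem t_one : (1 : Heisenberg).t = 0 := rfl
@[simp] theorem p_inv (x : Heisenberg) : (x⁻¹).p = -x.p := rfl
@[simp] theorem q_inv (x : Heisenberg) : (x⁻¹).q = -x.q := rfl
@[simp] theorem t_inv (x : Heisenberg) : (x⁻¹).t = -x.t := rfl

instance : Group Heisenberg :=
  Group.ofLeftAxioms
    (fun x y z => by apply ext_coord <;> simp <;> ring)
    (fun x => by apply ext_coord <;> simp)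
    (fun x => by apply ext_coord <;> simp; ring)

/-- The usual topology of `ℝ³`. -/
instance : TopologicalSpace Heisenberg := inferInstanceAs (TopologicalSpace (ℝ × ℝ × ℝ))

/-- The usual Borel structure and Lebesgue measure of `ℝ³`. -/
instance : MeasureSpace Heisenberg := inferInstanceAs (MeasureSpace (ℝ × ℝ × ℝ))

instance : BorelSpace Heisenberg := inferInstanceAs (BorelSpace (ℝ × ℝ × ℝ))

@[fun_prop] theorem continuous_p : Continuous p := continuous_fst
@[fun_prop] theorem continuous_q : Continuous q := continuous_fst.comp continuous_snd
@[fun_prop] theorem continuous_t : Continuous t := continuous_snd.comp continuous_snd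

theorem continuous_mk {X : Type*} [TopologicalSpace X] {a b c : X → ℝ} (ha : Continuous a)
    (hb : Continuous b) (hc : Continuous c) : Continuous fun x => mk (a x) (b x) (c x) :=
  ha.prodMk (hb.prodMk hc)

instance : IsTopologicalGroup Heisenberg where
  continuous_mul := continuous_mk (by fun_prop) (by fun_prop) (by fun_prop)
  continuous_inv := continuous_mk (by fun_prop) (by fun_prop) (by fun_prop)

theorem measurePreserving_mul (x : Heisenberg) :
    MeasurePreserving (fun y : Heisenberg => x * y) volume volume := by
  have h1 : ∀ c : ℝ, MeasurePreserving (fun s : ℝ => c + s) volume volume :=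
    fun c => measurePreserving_add_left volume c
  have h2 : ∀ p' : ℝ, MeasurePreserving
      (fun z : ℝ × ℝ => (x.q + z.1, (x.t + (x.p * z.1 - x.q * p') / 2) + z.2))
      (volume.prod volume) (volume.prod volume) := fun p' =>
    (h1 x.q).skew_product (g := fun q' s => (x.t + (x.p * q' - x.q * p') / 2) + s)
      (by fun_prop) (ae_of_all _ fun q' => (h1 _).map_eq)
  have h3 := (h1 x.p).skew_product
    (g := fun p' (z : ℝ × ℝ) => (x.q + z.1, (x.t + (x.p * z.1 - x.q * p') / 2) + z.2))
    (by fun_prop) (ae_of_all _ fun p' => (h2 p').map_eq)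
  have h4 : (fun y : Heisenberg => x * y) = fun y : ℝ × ℝ × ℝ =>
      (x.p + y.1, (x.q + y.2.1, (x.t + (x.p * y.2.1 - x.q * y.1) / 2) + y.2.2)) := by
    funext y
    refine ext_coord rfl rfl ?_
    change x.t + y.2.2 + (x.p * y.2.1 - x.q * y.1) / 2
      = (x.t + (x.p * y.2.1 - x.q * y.1) / 2) + y.2.2
    ring
  rw [h4]
  exact h3

/-- Lebesgue measure is a Haar measure of the Heisenberg group. -/
instance : (volume : Measure Heisenberg).IsHaarMeasure where
  map_mul_left_eq_self x := (measurePreserving_mul x).map_eq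
  lt_top_of_isCompact _ hK :=
    IsCompact.measure_lt_top (μ := (volume : Measure (ℝ × ℝ × ℝ))) hK
  open_pos _ hU hne :=
    IsOpen.measure_ne_zero (volume : Measure (ℝ × ℝ × ℝ)) hU hne

/-- The lattice `Γ_d`, the subgroup generated by `P = (1,0,0)`, `dQ = (0,d,0)` and
`Z = (0,0,1)`. -/
def lattice (d : ℕ) : Subgroup Heisenberg :=
  Subgroup.closure {mk 1 0 0, mk 0 d 0, mk 0 0 1}

/-- `sinc x = sin (π x) / (π x)`, with value `1` at `0`. -/
def sincPi (x : ℝ) : ℝ := Real.sinc (Real.pi * x)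

/-- The explicit function `S(p,q,t)` (real-valued). -/
def sincTypeReal (p q t : ℝ) : ℝ :=
  if 1 < |p| then 0
  else if q = 0 then (1 - |p|) / 4 * (2 * sincPi t - sincPi (t / 2) ^ 2)
  else 1 / 4 *
    ((t / q + (1 - |p|) / 2) * sincPi (t / 2 + (1 - |p|) / 4 * q) ^ 2
      - (t / q - (1 - |p|) / 2) * sincPi (t / 2 - (1 - |p|) / 4 * q) ^ 2)

/-- The explicit function `S` on the Heisenberg group, as a complex-valued function. -/
def sincType (x : Heisenberg) : ℂ := (sincTypeReal x.p x.q x.t : ℂ)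

end Heisenberg

end

/-! ### Normalised tight frames of a closed span in a Hilbert space. -/

section TightFrame

variable {E ι : Type*} [NormedAddCommGroup E] [InnerProductSpace ℂ E]

/-! Two identities for `S` carry everything. The reproducing identity `⟨λ(x)S, λ(y)S⟩ = S(y⁻¹x)`
makes point evaluation on the generated space an inner product with `λ(x)S`. The frame identity `∑
S(γ⁻¹x) S(y⁻¹γ) = S(y⁻¹x)`, summed over the lattice, is then Parseval's identity for the vectors
`λ(γ)S`, tested on the orbit of `S`. Parseval extends to the closed span and yields the sampling
formula; uniform convergence is Cauchy–Schwarz.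

The frame identity comes from a plane picture. By `integral_atom_mul_conj_atom`, `S(x⁻¹y)` is the
inner product of `atom x` and `atom y`, unimodular functions on double triangles sheared by the
first coordinate. For fixed integer first coordinate, the lattice atoms are conjugates of the
integer characters of the plane cut off to one double triangle, which fits in a sheared unit square,
so Fourier series give Parseval there. The integer shears of the double triangle tile the strip `|u|
≤ 1/2` up to the line `u = 0`. Hence `tsum_enorm_sq_integral_mul_conj_atom`, which is applied to
`atom x + atom y` and polarised.

The reproducing identity follows from the same sum: integrate over the unit cube, a fundamental
domain of volume one. The lattice sum of `|S(x⁻¹zγ) + S(y⁻¹zγ)|²` does not depend on `z`, so the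
integral over the group equals that sum.

Finally `‖S‖² = S(1) = 1/4`, so the frame vectors are not unit vectors. -/

theorem hasSum_inner_mul_inner_of_mem_span {η : ι → E} {A : Set E}
    (h : ∀ a ∈ A, ∀ b ∈ A, HasSum (fun i => inner ℂ a (η i) * inner ℂ (η i) b) (inner ℂ a b))
    {x y : E} (hx : x ∈ Submodule.span ℂ A) (hy : y ∈ Submodule.span ℂ A) :
    HasSum (fun i => inner ℂ x (η i) * inner ℂ (η i) y) (inner ℂ x y) := by
  induction hx, hy using Submodule.span_induction₂ with
  | mem_mem x y hx hy => exact h x hx y hy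
  | zero_left y hy => simp
  | zero_right x hx => simp
  | add_left x y z hx hy hz h1 h2 => simpa [inner_add_left, add_mul] using h1.add h2
  | add_right x y z hx hy hz h1 h2 => simpa [inner_add_right, mul_add] using h1.add h2
  | smul_left r x y hx hy h1 =>
    simpa only [inner_smul_left, mul_assoc] using h1.mul_left (starRingEnd ℂ r)
  | smul_right r x y hx hy h1 =>
    simpa [inner_smul_right, mul_left_comm] using h1.mul_left r

theorem hasSum_sq_norm_inner_of_mem_span {η : ι → E} {A : Set E}
    (h : ∀ a ∈ A, ∀ b ∈ A, HasSum (fun i => inner ℂ a (η i) * inner ℂ (η i) b) (inner ℂ a b))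
    {x : E} (hx : x ∈ Submodule.span ℂ A) :
    HasSum (fun i => ‖inner ℂ (η i) x‖ ^ 2) (‖x‖ ^ 2) := by
  have h1 := hasSum_inner_mul_inner_of_mem_span h hx hx
  have h2 : ∀ i, inner ℂ x (η i) * inner ℂ (η i) x = ((‖inner ℂ (η i) x‖ ^ 2 : ℝ) : ℂ) := by
    intro i
    rw [← inner_conj_symm x (η i), RCLike.conj_mul]
    norm_num
  rw [inner_self_eq_norm_sq_to_K] at h1
  simp_rw [h2] at h1
  have h3 : ((‖x‖ : ℂ) ^ 2) = ((‖x‖ ^ 2 : ℝ) : ℂ) := by norm_num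
  exact Complex.hasSum_ofReal.mp (h3 ▸ h1)

/-- Only finite partial sums are visibly continuous in `x`, so the inequality passes to the closure
at once. It makes the coefficient operator bounded, which in turn gives equality there. -/
theorem sum_sq_norm_inner_le_of_mem_closure_span {η : ι → E} {A : Set E}
    (h : ∀ a ∈ A, ∀ b ∈ A, HasSum (fun i => inner ℂ a (η i) * inner ℂ (η i) b) (inner ℂ a b))
    {x : E} (hx : x ∈ (Submodule.span ℂ A).topologicalClosure) (F : Finset ι) :
    ∑ i ∈ F, ‖inner ℂ (η i) x‖ ^ 2 ≤ ‖x‖ ^ 2 := by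
  have hcl : IsClosed {x : E | ∑ i ∈ F, ‖inner ℂ (η i) x‖ ^ 2 ≤ ‖x‖ ^ 2} :=
    isClosed_le (by fun_prop) (by fun_prop)
  exact closure_minimal (fun y hy => sum_le_hasSum F (fun _ _ => by positivity)
    (hasSum_sq_norm_inner_of_mem_span h hy)) hcl hx

/-- The coefficient operator of a family satisfying the Parseval identity on a total set. -/
theorem exists_coefficient_isometry {η : ι → E} {A : Set E}
    (h : ∀ a ∈ A, ∀ b ∈ A, HasSum (fun i => inner ℂ a (η i) * inner ℂ (η i) b) (inner ℂ a b)) :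
    ∃ T : (Submodule.span ℂ A).topologicalClosure →ₗᵢ[ℂ] lp (fun _ : ι => ℂ) 2,
      ∀ x i, T x i = inner ℂ (η i) (x : E) := by
  have hmem : ∀ x : (Submodule.span ℂ A).topologicalClosure,
      Memℓp (fun i => inner ℂ (η i) (x : E)) 2 := fun x =>
    memℓp_gen' (C := ‖(x : E)‖ ^ 2) fun F => by
      simpa using sum_sq_norm_inner_le_of_mem_closure_span h x.2 F
  let T₀ : (Submodule.span ℂ A).topologicalClosure →ₗ[ℂ] lp (fun _ : ι => ℂ) 2 :=
    { toFun := fun x => ⟨fun i => inner ℂ (η i) (x : E), hmem x⟩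
      map_add' := fun x y => by ext i; exact inner_add_right _ _ _
      map_smul' := fun c x => by ext i; exact inner_smul_right _ _ _ }
  have hT₀ : ∀ (x : (Submodule.span ℂ A).topologicalClosure) i,
      T₀ x i = inner ℂ (η i) (x : E) := fun x i => rfl
  have hnorm : ∀ x : (Submodule.span ℂ A).topologicalClosure,
      HasSum (fun i => ‖inner ℂ (η i) (x : E)‖ ^ 2) (‖T₀ x‖ ^ 2) := fun x => by
    simpa [hT₀] using lp.hasSum_norm (p := 2) (by norm_num) (T₀ x)
  -- The Bessel bound is needed only for continuity; the exact norm then follows by density.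
  let T₁ := T₀.mkContinuous 1 fun x => by
    rw [one_mul]
    refine le_of_sq_le_sq ?_ (norm_nonneg _)
    exact hasSum_le_of_sum_le (hnorm x)
      (sum_sq_norm_inner_le_of_mem_closure_span h x.2)
  have hdense : ∀ x, ‖T₀ x‖ = ‖x‖ := by
    intro x
    obtain ⟨u, hu, hux⟩ := mem_closure_iff_seq_limit.mp x.2
    let v : ℕ → (Submodule.span ℂ A).topologicalClosure :=
      fun n => ⟨u n, Submodule.le_topologicalClosure _ (hu n)⟩
    have hv : Tendsto v atTop (𝓝 x) := tendsto_subtype_rng.mpr hux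
    have h1 : Tendsto (fun n => ‖T₁ (v n)‖) atTop (𝓝 ‖T₁ x‖) :=
      ((T₁.continuous.tendsto x).comp hv).norm
    have h2 : ∀ n, ‖T₁ (v n)‖ = ‖v n‖ := fun n => by
      have := (hnorm (v n)).unique (hasSum_sq_norm_inner_of_mem_span h (hu n))
      exact (sq_eq_sq₀ (norm_nonneg _) (norm_nonneg _)).mp this
    simp_rw [h2] at h1
    exact tendsto_nhds_unique h1 hv.norm
  exact ⟨⟨T₀, hdense⟩, hT₀⟩

theorem hasSum_sq_norm_inner_of_mem_closure_span {η : ι → E} {A : Set E}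
    (h : ∀ a ∈ A, ∀ b ∈ A, HasSum (fun i => inner ℂ a (η i) * inner ℂ (η i) b) (inner ℂ a b))
    {x : E} (hx : x ∈ (Submodule.span ℂ A).topologicalClosure) :
    HasSum (fun i => ‖inner ℂ (η i) x‖ ^ 2) (‖x‖ ^ 2) := by
  obtain ⟨T, hT⟩ := exists_coefficient_isometry h
  have := lp.hasSum_norm (p := 2) (by norm_num) (T ⟨x, hx⟩)
  simpa [hT] using this

/-- The reconstruction formula of a normalised tight frame. -/
theorem hasSum_inner_smul_of_mem_closure_span [CompleteSpace E] {η : ι → E} {A : Set E}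
    (h : ∀ a ∈ A, ∀ b ∈ A, HasSum (fun i => inner ℂ a (η i) * inner ℂ (η i) b) (inner ℂ a b))
    (hη : ∀ i, η i ∈ (Submodule.span ℂ A).topologicalClosure)
    {x : E} (hx : x ∈ (Submodule.span ℂ A).topologicalClosure) :
    HasSum (fun i => inner ℂ (η i) x • η i) x := by
  classical
  obtain ⟨T, hT⟩ := exists_coefficient_isometry h
  have : CompleteSpace (Submodule.span ℂ A).topologicalClosure :=
    (Submodule.isClosed_topologicalClosure _).completeSpace_coe
  let T' := T.toContinuousLinearMap
  -- The adjoint is the synthesis operator, so applying it to the expansion of `T x` in unit vectors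
  -- gives the reconstruction, because `T* T = 1` for an isometry.
  have hsingle : ∀ i c, T'.adjoint (lp.single 2 i c) = c • ⟨η i, hη i⟩ := by
    intro i c
    refine ext_inner_left ℂ fun y => ?_
    rw [ContinuousLinearMap.adjoint_inner_right, lp.inner_single_right, inner_smul_right]
    change inner ℂ (T y i) c = _
    rw [hT, RCLike.inner_apply, inner_conj_symm]
    rfl
  have h1 := (lp.hasSum_single (p := 2) (by norm_num) (T' ⟨x, hx⟩)).mapL T'.adjoint
  have h2 : T'.adjoint (T' ⟨x, hx⟩) = ⟨x, hx⟩ := by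
    refine ext_inner_left ℂ fun y => ?_
    rw [ContinuousLinearMap.adjoint_inner_right]
    exact T.inner_map_map _ _
  rw [h2] at h1
  simp_rw [hsingle] at h1
  have h3 := h1.mapL (Submodule.span ℂ A).topologicalClosure.subtypeL
  have h4 : ∀ i, inner ℂ (η i) x = T' ⟨x, hx⟩ i := fun i => (hT ⟨x, hx⟩ i).symm
  simp_rw [h4]
  exact h3

end TightFrame

/-! ### From a reproducing function with the frame identity to a sampling space. -/

section SamplingOfReproducing

variable {G : Type*} [Group G] [TopologicalSpace G] [IsTopologicalGroup G]
  [MeasurableSpace G] [BorelSpace G] {μ : Measure G} [μ.IsHaarMeasure]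

theorem coeFn_leftRegular_toLp {S : G → ℂ} (hS : MemLp S 2 μ) (x : G) :
    leftRegular μ x (hS.toLp S) =ᵐ[μ] fun y => S (x⁻¹ * y) := by
  rw [leftRegular, Lp.toLp_compMeasurePreserving]
  exact MemLp.coeFn_toLp _

theorem leftRegular_leftRegular (x y : G) (f : Lp ℂ 2 μ) :
    leftRegular μ x (leftRegular μ y f) = leftRegular μ (x * y) f := by
  refine Lp.ext ?_
  have h1 := Lp.coeFn_compMeasurePreserving (leftRegular μ y f) (measurePreserving_mul_left μ x⁻¹)
  have h2 := (measurePreserving_mul_left μ x⁻¹).quasiMeasurePreserving.ae_eq_comp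
    (Lp.coeFn_compMeasurePreserving f (measurePreserving_mul_left μ y⁻¹))
  have h3 := Lp.coeFn_compMeasurePreserving f (measurePreserving_mul_left μ (x * y)⁻¹)
  refine h1.trans (h2.trans (Eventually.of_forall fun z => ?_) |>.trans h3.symm)
  simp [mul_assoc]

theorem isLeftInvariant_leftInvariantClosedSpan (f : Lp ℂ 2 μ) :
    IsLeftInvariant μ (leftInvariantClosedSpan μ f) := by
  intro x g hg
  let T := (Lp.compMeasurePreservingₗᵢ ℂ (E := ℂ) (p := 2) (fun y => x⁻¹ * y)
    (measurePreserving_mul_left μ x⁻¹)).toContinuousLinearMap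
  have hT : ∀ g, T g = leftRegular μ x g := fun _ => rfl
  rw [← hT]
  have h1 : Submodule.span ℂ (Set.range fun x : G => leftRegular μ x f) ≤
      (leftInvariantClosedSpan μ f).comap T.toLinearMap := by
    rw [Submodule.span_le]
    rintro _ ⟨y, rfl⟩
    refine Submodule.le_topologicalClosure _ (Submodule.subset_span ⟨x * y, ?_⟩)
    exact (leftRegular_leftRegular x y f).symm
  exact closure_minimal h1
    ((Submodule.isClosed_topologicalClosure _).preimage T.continuous) hg

theorem leftRegular_mem_leftInvariantClosedSpan (f : Lp ℂ 2 μ) (x : G) :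
    leftRegular μ x f ∈ leftInvariantClosedSpan μ f :=
  Submodule.le_topologicalClosure _ (Submodule.subset_span ⟨x, rfl⟩)

theorem leftRegular_one (f : Lp ℂ 2 μ) : leftRegular μ 1 f = f := by
  refine Lp.ext ?_
  refine (Lp.coeFn_compMeasurePreserving f (measurePreserving_mul_left μ (1 : G)⁻¹)).trans ?_
  exact Eventually.of_forall fun z => by simp

variable {S : G → ℂ} {hS : MemLp S 2 μ}

/-- The reproducing identity writes `‖λ(y)S - λ(x)S‖²` in terms of values of `S`, so strong
continuity of the orbit reduces to continuity of `S`. -/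
theorem continuous_leftRegular_of_reproducing (hc : Continuous S)
    (hrep : ∀ x y, inner ℂ (leftRegular μ x (hS.toLp S)) (leftRegular μ y (hS.toLp S))
      = S (y⁻¹ * x)) :
    Continuous fun x => leftRegular μ x (hS.toLp S) := by
  rw [continuous_iff_continuousAt]
  intro x
  rw [ContinuousAt, tendsto_iff_norm_sub_tendsto_zero]
  have h1 : ∀ y, ‖leftRegular μ y (hS.toLp S) - leftRegular μ x (hS.toLp S)‖
      = √(RCLike.re (S 1 - S (x⁻¹ * y) - S (y⁻¹ * x) + S 1)) := by
    intro y
    rw [norm_eq_sqrt_re_inner (𝕜 := ℂ), inner_sub_sub_self, hrep, hrep, hrep, hrep,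
      inv_mul_cancel, inv_mul_cancel]
  simp_rw [h1]
  have h2 : Continuous fun y : G => √(RCLike.re (S 1 - S (x⁻¹ * y) - S (y⁻¹ * x) + S 1)) := by
    fun_prop
  have h3 := h2.tendsto x
  simpa using h3

/-- A continuous function reproducing under convolution reproduces the space it generates. -/
theorem coeFn_eq_inner_of_reproducing
    (hrep : ∀ x y, inner ℂ (leftRegular μ x (hS.toLp S)) (leftRegular μ y (hS.toLp S))
      = S (y⁻¹ * x))
    {φ : Lp ℂ 2 μ} (hφ : φ ∈ leftInvariantClosedSpan μ (hS.toLp S)) :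
    φ =ᵐ[μ] fun x => inner ℂ (leftRegular μ x (hS.toLp S)) φ := by
  have hspan : ∀ ψ ∈ Submodule.span ℂ (Set.range fun x : G => leftRegular μ x (hS.toLp S)),
      ψ =ᵐ[μ] fun x => inner ℂ (leftRegular μ x (hS.toLp S)) ψ := by
    intro ψ hψ
    induction hψ using Submodule.span_induction with
    | mem ψ h =>
      obtain ⟨y, rfl⟩ := h
      simp_rw [hrep]
      exact coeFn_leftRegular_toLp hS y
    | zero =>
      simp_rw [inner_zero_right]
      exact Lp.coeFn_zero _ _ _
    | add ψ₁ ψ₂ _ _ h₁ h₂ =>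
      simp_rw [inner_add_right]
      exact (Lp.coeFn_add ψ₁ ψ₂).trans (h₁.add h₂)
    | smul c ψ _ h =>
      simp_rw [inner_smul_right]
      filter_upwards [Lp.coeFn_smul c ψ, h] with x hx hx'
      rw [hx, Pi.smul_apply, hx', smul_eq_mul]
  -- A subsequence of an `L²`-convergent sequence converges almost everywhere, while the inner
  -- products converge at every point; the two limits must agree.
  obtain ⟨u, hu, hux⟩ := mem_closure_iff_seq_limit.mp hφ
  obtain ⟨ns, hns, hae⟩ := (tendstoInMeasure_of_tendsto_Lp hux).exists_seq_tendsto_ae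
  have hall := ae_all_iff.mpr fun n => hspan (u n) (hu n)
  filter_upwards [hae, hall] with x hx hx'
  refine tendsto_nhds_unique hx ?_
  simp_rw [hx']
  exact (Continuous.inner continuous_const continuous_id).tendsto φ |>.comp
    (hux.comp hns.tendsto_atTop)

theorem eq_inner_of_continuous_of_reproducing (hc : Continuous S)
    (hrep : ∀ x y, inner ℂ (leftRegular μ x (hS.toLp S)) (leftRegular μ y (hS.toLp S))
      = S (y⁻¹ * x))
    {f : G → ℂ} (hf : Continuous f) (hf2 : MemLp f 2 μ)
    (hfH : hf2.toLp f ∈ leftInvariantClosedSpan μ (hS.toLp S)) (x : G) :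
    f x = inner ℂ (leftRegular μ x (hS.toLp S)) (hf2.toLp f) := by
  have h1 := hf2.coeFn_toLp.symm.trans (coeFn_eq_inner_of_reproducing hrep hfH)
  have hcont : Continuous fun x => inner ℂ (leftRegular μ x (hS.toLp S)) (hf2.toLp f) :=
    (continuous_leftRegular_of_reproducing hc hrep).inner continuous_const
  exact congrFun ((hf.ae_eq_iff_eq μ hcont).mp h1) x

variable {Γ : Set G}

theorem hasSum_inner_leftRegular_mul_inner
    (hrep : ∀ x y, inner ℂ (leftRegular μ x (hS.toLp S)) (leftRegular μ y (hS.toLp S))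
      = S (y⁻¹ * x))
    (hframe : ∀ x y, HasSum (fun γ : Γ => S ((γ : G)⁻¹ * x) * S (y⁻¹ * γ)) (S (y⁻¹ * x))) :
    ∀ a ∈ Set.range fun x : G => leftRegular μ x (hS.toLp S),
      ∀ b ∈ Set.range fun x : G => leftRegular μ x (hS.toLp S),
      HasSum (fun γ : Γ => inner ℂ a (leftRegular μ (γ : G) (hS.toLp S))
        * inner ℂ (leftRegular μ (γ : G) (hS.toLp S)) b) (inner ℂ a b) := by
  rintro _ ⟨x, rfl⟩ _ ⟨y, rfl⟩
  simpa only [hrep] using hframe x y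

theorem isTightFrameOf_of_reproducing
    (hrep : ∀ x y, inner ℂ (leftRegular μ x (hS.toLp S)) (leftRegular μ y (hS.toLp S))
      = S (y⁻¹ * x))
    (hframe : ∀ x y, HasSum (fun γ : Γ => S ((γ : G)⁻¹ * x) * S (y⁻¹ * γ)) (S (y⁻¹ * x))) :
    IsTightFrameOf (leftInvariantClosedSpan μ (hS.toLp S))
      (fun γ : Γ => leftRegular μ (γ : G) (hS.toLp S)) 1 where
  pos := one_pos
  mem γ := leftRegular_mem_leftInvariantClosedSpan _ _
  hasSum φ hφ := by
    rw [one_mul]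
    exact hasSum_sq_norm_inner_of_mem_closure_span
      (hasSum_inner_leftRegular_mul_inner hrep hframe) hφ

theorem isSamplingConstant_of_reproducing (hc : Continuous S)
    (hrep : ∀ x y, inner ℂ (leftRegular μ x (hS.toLp S)) (leftRegular μ y (hS.toLp S))
      = S (y⁻¹ * x))
    (hframe : ∀ x y, HasSum (fun γ : Γ => S ((γ : G)⁻¹ * x) * S (y⁻¹ * γ)) (S (y⁻¹ * x))) :
    IsSamplingConstant μ Γ (leftInvariantClosedSpan μ (hS.toLp S)) 1 := by
  refine ⟨one_pos, fun f hf hf2 hfH => ?_⟩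
  simp_rw [eq_inner_of_continuous_of_reproducing hc hrep hf hf2 hfH]
  exact (isTightFrameOf_of_reproducing hrep hframe).hasSum _ hfH

theorem isSincTypeFunction_of_reproducing (hc : Continuous S)
    (hrep : ∀ x y, inner ℂ (leftRegular μ x (hS.toLp S)) (leftRegular μ y (hS.toLp S))
      = S (y⁻¹ * x))
    (hframe : ∀ x y, HasSum (fun γ : Γ => S ((γ : G)⁻¹ * x) * S (y⁻¹ * γ)) (S (y⁻¹ * x))) :
    IsSincTypeFunction μ Γ (leftInvariantClosedSpan μ (hS.toLp S)) S := by
  have hL2 : ∀ f : G → ℂ, Continuous f → ∀ hf : MemLp f 2 μ,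
      hf.toLp f ∈ leftInvariantClosedSpan μ (hS.toLp S) →
      HasSum (fun γ : Γ => f γ • leftRegular μ (γ : G) (hS.toLp S)) (hf.toLp f) := by
    intro f hf hf2 hfH
    have h := hasSum_inner_smul_of_mem_closure_span
      (hasSum_inner_leftRegular_mul_inner hrep hframe)
      (fun γ => leftRegular_mem_leftInvariantClosedSpan _ _) hfH
    simpa only [← eq_inner_of_continuous_of_reproducing hc hrep hf hf2 hfH] using h
  refine ⟨hc, hS, ?_, hL2, fun f hf hf2 hfH => ?_⟩
  · simpa only [leftRegular_one] using leftRegular_mem_leftInvariantClosedSpan (hS.toLp S) (1 : G)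
  · have hL := hL2 f hf hf2 hfH
    have hnorm : ∀ x : G, ‖leftRegular μ x (hS.toLp S)‖ = ‖hS.toLp S‖ := fun x =>
      (Lp.compMeasurePreservingₗᵢ ℂ (E := ℂ) (p := 2) (fun y => x⁻¹ * y)
        (measurePreserving_mul_left μ x⁻¹)).norm_map _
    -- The pointwise error is the inner product of the `L²` error with `λ(x)S`, whose norm is
    -- independent of `x`.
    have hdist : ∀ (F : Finset Γ) (x : G), dist (f x) (∑ γ ∈ F, f γ * S ((γ : G)⁻¹ * x)) ≤
        ‖hS.toLp S‖ *
          ‖hf2.toLp f - ∑ γ ∈ F, f γ • leftRegular μ (γ : G) (hS.toLp S)‖ := by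
      intro F x
      have h1 : f x - ∑ γ ∈ F, f γ * S ((γ : G)⁻¹ * x) =
          inner ℂ (leftRegular μ x (hS.toLp S))
            (hf2.toLp f - ∑ γ ∈ F, f γ • leftRegular μ (γ : G) (hS.toLp S)) := by
        rw [inner_sub_right, inner_sum,
          ← eq_inner_of_continuous_of_reproducing hc hrep hf hf2 hfH]
        simp_rw [inner_smul_right, hrep]
      rw [dist_eq_norm, h1, ← hnorm x]
      exact norm_inner_le_norm _ _
    have hlim : Tendsto (fun F : Finset Γ => ‖hS.toLp S‖ *
        ‖hf2.toLp f - ∑ γ ∈ F, f γ • leftRegular μ (γ : G) (hS.toLp S)‖) atTop (𝓝 0) := by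
      have h2 : Tendsto (fun F : Finset Γ =>
          hf2.toLp f - ∑ γ ∈ F, f γ • leftRegular μ (γ : G) (hS.toLp S)) atTop (𝓝 0) := by
        simpa using (tendsto_const_nhds (x := hf2.toLp f)).sub hL
      simpa using h2.norm.const_mul ‖hS.toLp S‖
    rw [Metric.tendstoUniformly_iff]
    intro ε hε
    filter_upwards [hlim.eventually_lt_const hε] with F hF x
    exact (hdist F x).trans_lt hF

theorem isSamplingSpace_of_reproducing (hc : Continuous S)
    (hrep : ∀ x y, inner ℂ (leftRegular μ x (hS.toLp S)) (leftRegular μ y (hS.toLp S))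
      = S (y⁻¹ * x))
    (hframe : ∀ x y, HasSum (fun γ : Γ => S ((γ : G)⁻¹ * x) * S (y⁻¹ * γ)) (S (y⁻¹ * x))) :
    IsSamplingSpace μ Γ (leftInvariantClosedSpan μ (hS.toLp S)) where
  isClosed := Submodule.isClosed_topologicalClosure _
  leftInvariant := isLeftInvariant_leftInvariantClosedSpan _
  exists_continuous _ hφ :=
    ⟨_, (continuous_leftRegular_of_reproducing hc hrep).inner continuous_const,
      coeFn_eq_inner_of_reproducing hrep hφ⟩
  exists_constant := ⟨1, isSamplingConstant_of_reproducing hc hrep hframe⟩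
  exists_sincType := ⟨S, isSincTypeFunction_of_reproducing hc hrep hframe⟩

end SamplingOfReproducing

/-! ### Integral representations of `S`. -/

namespace Heisenberg

theorem integral_sin_two_pi_mul (τ : ℝ) :
    ∫ u in (0 : ℝ)..1 / 2, Real.sin (2 * Real.pi * u * τ)
      = Real.pi * τ / 4 * sincPi (τ / 2) ^ 2 := by
  rcases eq_or_ne τ 0 with rfl | hτ
  · simp
  have hπ := Real.pi_ne_zero
  have hc : 2 * Real.pi * τ ≠ 0 := by positivity
  have h1 : ∀ u, Real.sin (2 * Real.pi * u * τ) = Real.sin (2 * Real.pi * τ * u) := fun u => by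
    ring_nf
  simp_rw [h1]
  rw [intervalIntegral.integral_comp_mul_left (fun x => Real.sin x) hc, integral_sin,
    sincPi, Real.sinc_of_ne_zero (by positivity)]
  have h2 : Real.cos (2 * Real.pi * τ * (1 / 2)) = 1 - 2 * Real.sin (Real.pi * (τ / 2)) ^ 2 := by
    rw [show 2 * Real.pi * τ * (1 / 2) = 2 * (Real.pi * (τ / 2)) by ring, Real.cos_two_mul,
      Real.cos_sq']
    ring
  rw [h2, mul_zero, Real.cos_zero, smul_eq_mul]
  field_simp
  ring

theorem integral_mul_cos_two_pi_mul (t : ℝ) :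
    ∫ u in (0 : ℝ)..1 / 2, u * Real.cos (2 * Real.pi * u * t)
      = (2 * sincPi t - sincPi (t / 2) ^ 2) / 8 := by
  rcases eq_or_ne t 0 with rfl | ht
  · simp [sincPi, integral_id]
    norm_num
  have hπ := Real.pi_ne_zero
  -- Antiderivative found by integrating by parts.
  have hd : ∀ u : ℝ, HasDerivAt (fun u => u * Real.sin (2 * Real.pi * u * t) / (2 * Real.pi * t)
      + Real.cos (2 * Real.pi * u * t) / (2 * Real.pi * t) ^ 2)
      (u * Real.cos (2 * Real.pi * u * t)) u := by
    intro u
    have h0 : HasDerivAt (fun u : ℝ => 2 * Real.pi * u * t) (2 * Real.pi * t) u := by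
      simpa using ((hasDerivAt_id u).const_mul (2 * Real.pi)).mul_const t
    have h1 := (((hasDerivAt_id u).mul h0.sin).div_const (2 * Real.pi * t)).add
      (h0.cos.div_const ((2 * Real.pi * t) ^ 2))
    refine h1.congr_deriv ?_
    simp only [id]
    field_simp
    ring
  rw [intervalIntegral.integral_eq_sub_of_hasDerivAt (fun u _ => hd u)
    (Continuous.intervalIntegrable (by fun_prop) _ _), sincPi, sincPi,
    Real.sinc_of_ne_zero (by positivity), Real.sinc_of_ne_zero (by positivity)]
  have h2 : Real.cos (2 * Real.pi * (1 / 2) * t) = 1 - 2 * Real.sin (Real.pi * (t / 2)) ^ 2 := by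
    rw [show 2 * Real.pi * (1 / 2) * t = 2 * (Real.pi * (t / 2)) by ring, Real.cos_two_mul,
      Real.cos_sq']
    ring
  rw [h2, show 2 * Real.pi * (1 / 2) * t = Real.pi * t by ring]
  simp
  field_simp
  ring

/-- The cutoff `max 0 ((1 - |p|) / 2)` merges the three cases into one jointly continuous integrand,
from which continuity of `S` is immediate. For `q ≠ 0` the product of cosine and sine splits into
sines at `t ± mq`, one for each `sinc²` term. -/
theorem sincTypeReal_eq_integral (p q t : ℝ) :
    sincTypeReal p q t = ∫ u in (0 : ℝ)..1 / 2, 2 * (Real.cos (2 * Real.pi * u * t) *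
      (2 * (u * max 0 ((1 - |p|) / 2)) *
        Real.sinc (2 * Real.pi * (u * max 0 ((1 - |p|) / 2)) * q))) := by
  have hπ := Real.pi_ne_zero
  rw [sincTypeReal]
  split_ifs with hp hq
  · rw [max_eq_left (by linarith)]
    simp
  · subst hq
    rw [max_eq_right (by linarith)]
    have h1 : ∀ u : ℝ, 2 * (Real.cos (2 * Real.pi * u * t) * (2 * (u * ((1 - |p|) / 2)) *
        Real.sinc (2 * Real.pi * (u * ((1 - |p|) / 2)) * 0)))
        = 2 * (1 - |p|) * (u * Real.cos (2 * Real.pi * u * t)) := fun u => by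
      rw [mul_zero, Real.sinc_zero]
      ring
    simp_rw [h1]
    rw [intervalIntegral.integral_const_mul, integral_mul_cos_two_pi_mul]
    ring
  · rw [max_eq_right (by linarith)]
    set m := (1 - |p|) / 2 with hm
    have h1 : ∀ u : ℝ, 2 * (Real.cos (2 * Real.pi * u * t) * (2 * (u * m) *
        Real.sinc (2 * Real.pi * (u * m) * q)))
        = 1 / (Real.pi * q) * (Real.sin (2 * Real.pi * u * (t + m * q))
          - Real.sin (2 * Real.pi * u * (t - m * q))) := fun u => by
      have h2 : 2 * (u * m) * Real.sinc (2 * Real.pi * (u * m) * q)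
          = Real.sin (2 * Real.pi * (u * m) * q) / (Real.pi * q) := by
        rcases eq_or_ne (u * m) 0 with h | h
        · simp [h]
        · rw [Real.sinc_of_ne_zero (by positivity)]
          have hu := left_ne_zero_of_mul h
          have hm0 := right_ne_zero_of_mul h
          field_simp
      rw [h2, show 2 * Real.pi * u * (t + m * q) = 2 * Real.pi * u * t + 2 * Real.pi * (u * m) * q
        by ring, show 2 * Real.pi * u * (t - m * q) = 2 * Real.pi * u * t
        - 2 * Real.pi * (u * m) * q by ring, Real.sin_add, Real.sin_sub]
      ring
    simp_rw [h1]
    rw [intervalIntegral.integral_const_mul, intervalIntegral.integral_sub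
      (Continuous.intervalIntegrable (by fun_prop) _ _)
      (Continuous.intervalIntegrable (by fun_prop) _ _),
      integral_sin_two_pi_mul, integral_sin_two_pi_mul,
      show (t + m * q) / 2 = t / 2 + (1 - |p|) / 4 * q by rw [hm]; ring,
      show (t - m * q) / 2 = t / 2 - (1 - |p|) / 4 * q by rw [hm]; ring]
    field_simp

theorem continuous_sincType : Continuous sincType := by
  have h : Continuous fun x : Heisenberg => sincTypeReal x.p x.q x.t := by
    simp_rw [sincTypeReal_eq_integral]
    refine intervalIntegral.continuous_parametric_intervalIntegral_of_continuous' ?_ _ _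
    have := Real.continuous_sinc
    fun_prop
  exact Complex.continuous_ofReal.comp h

theorem sincTypeReal_zero : sincTypeReal 0 0 0 = 1 / 4 := by
  simp [sincTypeReal, sincPi]
  norm_num

theorem sincType_one : sincType 1 = 1 / 4 := by
  rw [sincType, p_one, q_one, t_one, sincTypeReal_zero]
  norm_num

/-- The character `θ ↦ exp (2πiθ)` of the real line. -/
noncomputable def phase (θ : ℝ) : ℂ := Complex.exp (2 * Real.pi * θ * Complex.I)

theorem phase_eq (θ : ℝ) : phase θ = Complex.exp ((2 * Real.pi * θ : ℝ) * Complex.I) := by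
  simp [phase]

theorem phase_add (θ θ' : ℝ) : phase (θ + θ') = phase θ * phase θ' := by
  rw [phase, phase, phase, ← Complex.exp_add]
  push_cast
  ring_nf

theorem norm_phase (θ : ℝ) : ‖phase θ‖ = 1 := by
  rw [phase_eq, Complex.norm_exp_ofReal_mul_I]

theorem conj_phase (θ : ℝ) : starRingEnd ℂ (phase θ) = phase (-θ) := by
  rw [phase_eq, phase_eq, ← Complex.exp_conj, map_mul, Complex.conj_ofReal, Complex.conj_I]
  push_cast
  ring_nf

@[fun_prop] theorem continuous_phase : Continuous phase := by
  unfold phase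
  fun_prop

theorem phase_add_phase_neg (θ : ℝ) :
    phase θ + phase (-θ) = ((2 * Real.cos (2 * Real.pi * θ) : ℝ) : ℂ) := by
  rw [phase, phase]
  push_cast
  rw [Complex.two_cos]
  congr 2
  ring

theorem integral_phase_mul (r q : ℝ) :
    ∫ v in -r..r, phase (v * q) = ((2 * r * Real.sinc (2 * Real.pi * r * q) : ℝ) : ℂ) := by
  rcases eq_or_ne q 0 with rfl | hq
  · simp [phase]
    ring
  have hπ := Real.pi_ne_zero
  have hc : 2 * Real.pi * q ≠ 0 := by positivity
  have h1 : ∀ v : ℝ, phase (v * q) = Complex.exp (((2 * Real.pi * q) * v : ℝ) * Complex.I) :=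
    fun v => by rw [phase_eq]; ring_nf
  simp_rw [h1]
  rw [intervalIntegral.integral_comp_mul_left
    (fun x : ℝ => Complex.exp ((x : ℂ) * Complex.I)) hc, mul_neg, integral_exp_mul_I_eq_sinc,
    show 2 * Real.pi * q * r = 2 * Real.pi * r * q by ring, Complex.real_smul]
  push_cast
  have : (Real.pi : ℂ) ≠ 0 := by exact_mod_cast hπ
  have : (q : ℂ) ≠ 0 := by exact_mod_cast hq
  field_simp

/-- Folding `u` onto `-u` leaves the even factor alone and turns the two phases into a cosine. -/
theorem integral_phase_mul_abs (g : ℝ → ℝ) (hg : Continuous g) (t : ℝ) :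
    ∫ u in (-(1 / 2 : ℝ))..1 / 2, phase (u * t) * (g |u| : ℂ)
      = ((∫ u in (0 : ℝ)..1 / 2, 2 * (Real.cos (2 * Real.pi * u * t) * g u) : ℝ) : ℂ) := by
  have hc : Continuous fun u : ℝ => phase (u * t) * (g |u| : ℂ) := by fun_prop
  rw [← intervalIntegral.integral_add_adjacent_intervals (b := 0)
    (hc.intervalIntegrable _ _) (hc.intervalIntegrable _ _)]
  have h1 := intervalIntegral.integral_comp_neg (a := 0) (b := 1 / 2)
    (fun u : ℝ => phase (u * t) * (g |u| : ℂ))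
  rw [neg_zero] at h1
  rw [← h1, ← intervalIntegral.integral_add
    (Continuous.intervalIntegrable (by fun_prop) _ _) (hc.intervalIntegrable _ _),
    ← intervalIntegral.integral_ofReal]
  refine intervalIntegral.integral_congr fun u hu => ?_
  rw [Set.uIcc_of_le (by norm_num)] at hu
  simp only [abs_neg, abs_of_nonneg hu.1, ← add_mul, neg_mul]
  rw [add_comm, phase_add_phase_neg]
  push_cast
  ring_nf

theorem sincTypeReal_eq_integral_phase (p q t : ℝ) :
    (sincTypeReal p q t : ℂ) = ∫ u in (-(1 / 2 : ℝ))..1 / 2, phase (u * t) *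
      ∫ v in -(|u| * max 0 ((1 - |p|) / 2))..|u| * max 0 ((1 - |p|) / 2), phase (v * q) := by
  simp_rw [integral_phase_mul]
  rw [integral_phase_mul_abs (fun u => 2 * (u * max 0 ((1 - |p|) / 2)) *
    Real.sinc (2 * Real.pi * (u * max 0 ((1 - |p|) / 2)) * q)), sincTypeReal_eq_integral]
  have := Real.continuous_sinc
  fun_prop

end Heisenberg

/-! ### Parseval identities on the line and the plane. -/

namespace Heisenberg

open scoped ENNReal

theorem integrable_of_bounded_of_support {α : Type*} [MeasurableSpace α] {μ : Measure α}
    {f : α → ℂ} (hf : Measurable f) {C : ℝ} (hC : ∀ x, ‖f x‖ ≤ C) {s : Set α}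
    (hμ : μ s ≠ ∞) (hsupp : ∀ x ∉ s, f x = 0) : Integrable f μ := by
  have h : IntegrableOn f s μ := by
    refine Measure.integrableOn_of_bounded (M := C) hμ hf.aestronglyMeasurable ?_
    exact Eventually.of_forall hC
  exact h.integrable_of_forall_notMem_eq_zero hsupp

/-- Parseval's identity for functions on the line supported in an interval of length one. -/
theorem tsum_enorm_sq_integral_mul_phase {f : ℝ → ℂ} (hf : Measurable f) {C : ℝ}
    (hC : ∀ x, ‖f x‖ ≤ C) (a : ℝ) (hsupp : ∀ x ∉ Set.Ioc a (a + 1), f x = 0) :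
    ∑' n : ℤ, ‖∫ x, f x * phase (x * n)‖ₑ ^ 2 = ∫⁻ x, ‖f x‖ₑ ^ 2 := by
  have hab : a < a + 1 := by linarith
  have hL2 : MemLp f 2 (volume.restrict (Set.Ioc a (a + 1))) :=
    MemLp.of_bound hf.aestronglyMeasurable C (Eventually.of_forall hC)
  have h1 := hasSum_sq_fourierCoeffOn hab hL2
  -- Fourier coefficients carry the conjugate character, hence the index `-n`; the sum over all
  -- integers does not notice.
  have hcoeff : ∀ n : ℤ, fourierCoeffOn hab f (-n) = ∫ x, f x * phase (x * n) := by
    intro n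
    rw [fourierCoeffOn_eq_integral, intervalIntegral.integral_of_le hab.le, neg_neg,
      setIntegral_eq_integral_of_forall_compl_eq_zero]
    · simp only [add_sub_cancel_left, div_one, one_smul]
      refine integral_congr_ae (Eventually.of_forall fun x => ?_)
      simp only [fourier_coe_apply, smul_eq_mul, phase]
      rw [mul_comm]
      congr 2
      push_cast
      ring
    · intro x hx
      rw [hsupp x hx, smul_zero]
  have h2 : HasSum (fun n : ℤ => ‖∫ x, f x * phase (x * n)‖ ^ 2) (∫ x, ‖f x‖ ^ 2) := by
    have h3 := (Equiv.neg ℤ).hasSum_iff.mpr h1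
    rw [intervalIntegral.integral_of_le hab.le,
      setIntegral_eq_integral_of_forall_compl_eq_zero (fun x hx => by simp [hsupp x hx])] at h3
    simpa [Function.comp_def, hcoeff] using h3
  have h4 : ∀ z : ℂ, ‖z‖ₑ ^ 2 = ENNReal.ofReal (‖z‖ ^ 2) := fun z => by
    rw [ENNReal.ofReal_pow (norm_nonneg _), ofReal_norm]
  simp_rw [h4]
  rw [← ENNReal.ofReal_tsum_of_nonneg (fun _ => by positivity) h2.summable, h2.tsum_eq,
    ofReal_integral_eq_lintegral_ofReal _ (Eventually.of_forall fun _ => by positivity)]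
  have h5 : IntegrableOn (fun x => ‖f x‖ ^ 2) (Set.Ioc a (a + 1)) := by
    exact hL2.integrable_norm_pow (p := 2) (by norm_num)
  exact h5.integrable_of_forall_notMem_eq_zero fun x hx => by simp [hsupp x hx]

/-- Parseval's identity for functions on the plane supported in a sheared unit square. -/
theorem tsum_enorm_sq_integral_mul_phase_prod {W : ℝ × ℝ → ℂ} (hW : Measurable W) {C : ℝ}
    (hC : ∀ z, ‖W z‖ ≤ C) {a : ℝ} {c : ℝ → ℝ} (hInt : Integrable W)
    (hu : ∀ z, z.1 ∉ Set.Ioc a (a + 1) → W z = 0)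
    (hv : ∀ z, z.2 ∉ Set.Ioc (c z.1) (c z.1 + 1) → W z = 0) :
    ∑' n : ℤ, ∑' k : ℤ, ‖∫ z, W z * phase (z.1 * k + z.2 * n)‖ₑ ^ 2 = ∫⁻ z, ‖W z‖ₑ ^ 2 := by
  -- Partial Fourier coefficients in `v`. Parseval in `u` is used for each `n`, then Parseval in `v`
  -- for each `u`; the window in `v` may therefore move with `u`.
  let A : ℤ → ℝ → ℂ := fun n u => ∫ v, W (u, v) * phase (v * n)
  have hC0 : 0 ≤ C := (norm_nonneg _).trans (hC 0)
  have hmeas : ∀ n, Measurable (A n) := fun n => by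
    have h : Measurable fun z : ℝ × ℝ => W z * phase (z.2 * n) := by fun_prop
    exact h.stronglyMeasurable.integral_prod_right'.measurable
  have hbound : ∀ n u, ‖A n u‖ ≤ C := fun n u => by
    have h1 : A n u = ∫ v in Set.Ioc (c u) (c u + 1), W (u, v) * phase (v * n) := by
      rw [setIntegral_eq_integral_of_forall_compl_eq_zero]
      intro v hv'
      rw [hv (u, v) hv', zero_mul]
    rw [h1]
    refine (norm_setIntegral_le_of_norm_le_const (C := C) (by simp) fun v _ => ?_).trans ?_
    · rw [norm_mul, norm_phase, mul_one]
      exact hC _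
    · simp
  have hcoeff : ∀ n k : ℤ, ∫ z, W z * phase (z.1 * k + z.2 * n)
      = ∫ u, A n u * phase (u * k) := by
    intro n k
    have hi : Integrable (fun z : ℝ × ℝ => W z * phase (z.1 * k + z.2 * n)) := by
      refine hInt.mul_bdd (c := 1) (Measurable.aestronglyMeasurable (by fun_prop)) ?_
      exact Eventually.of_forall fun z => (norm_phase _).le
    rw [Measure.volume_eq_prod] at hi ⊢
    rw [integral_prod _ hi]
    congr 1 with u
    simp only [A]
    rw [← integral_mul_const]
    congr 1 with v
    rw [phase_add]
    ring
  simp_rw [hcoeff]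
  have h1 : ∀ n, ∑' k : ℤ, ‖∫ u, A n u * phase (u * k)‖ₑ ^ 2 = ∫⁻ u, ‖A n u‖ₑ ^ 2 := fun n =>
    tsum_enorm_sq_integral_mul_phase (hmeas n) (hbound n) a fun u hu' => by
      simp only [A, hu (u, _) hu', zero_mul, integral_zero]
  simp_rw [h1]
  rw [← lintegral_tsum fun n => ((hmeas n).enorm.pow_const 2).aemeasurable,
    Measure.volume_eq_prod, lintegral_prod _ (hW.enorm.pow_const 2).aemeasurable]
  refine lintegral_congr fun u => ?_
  exact tsum_enorm_sq_integral_mul_phase (by fun_prop) (fun v => hC (u, v)) (c u)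
    fun v hv' => hv (u, v) hv'

end Heisenberg

/-! ### The frequency picture: sheared double triangles tiling a strip. -/

namespace Heisenberg

open scoped ENNReal

/-- The support of `atom x`: a double triangle, sheared by `x.p`. -/
def atomSupport (p : ℝ) : Set (ℝ × ℝ) :=
  {z | z.1 ∈ Set.Ioc (-(1 / 2) : ℝ) (1 / 2) ∧
    z.2 + z.1 * p ∈ Set.Ioc (-(|z.1| / 2)) (|z.1| / 2)}

open Classical in
/-- The translates of `S` in the frequency picture: the inner product of `atom x` and `atom y`
is `S (x⁻¹ y)`. -/
noncomputable def atom (x : Heisenberg) (z : ℝ × ℝ) : ℂ :=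
  if z ∈ atomSupport x.p then phase (-(z.1 * x.t + x.q * (z.2 + z.1 * x.p / 2))) else 0

theorem measurableSet_atomSupport (p : ℝ) : MeasurableSet (atomSupport p) := by
  refine (measurable_fst measurableSet_Ioc).inter ?_
  exact (measurableSet_lt (f := fun z : ℝ × ℝ => -(|z.1| / 2)) (g := fun z => z.2 + z.1 * p)
    (by fun_prop) (by fun_prop)).inter
    (measurableSet_le (f := fun z : ℝ × ℝ => z.2 + z.1 * p) (g := fun z => |z.1| / 2)
      (by fun_prop) (by fun_prop))

theorem measurable_atom (x : Heisenberg) : Measurable (atom x) := by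
  classical
  exact Measurable.ite (measurableSet_atomSupport _) (by fun_prop) measurable_const

theorem norm_atom_le (x : Heisenberg) (z : ℝ × ℝ) : ‖atom x z‖ ≤ 1 := by
  rw [atom]
  split_ifs
  · exact (norm_phase _).le
  · simp

theorem atom_eq_zero {x : Heisenberg} {z : ℝ × ℝ} (h : z ∉ atomSupport x.p) : atom x z = 0 :=
  if_neg h

theorem volume_atomSupport_ne_top (p : ℝ) : volume (atomSupport p) ≠ ∞ := by
  have h : atomSupport p ⊆ Set.Icc (-(1 / 2)) (1 / 2) ×ˢ Set.Icc (-(1 + |p|)) (1 + |p|) := by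
    rintro ⟨u, v⟩ ⟨⟨h1, h2⟩, h3, h4⟩
    simp only at h1 h2 h3 h4
    have hu : |u| ≤ 1 / 2 := abs_le.mpr ⟨h1.le, h2⟩
    have hup : |u * p| ≤ |p| := by
      rw [abs_mul]
      exact mul_le_of_le_one_left (abs_nonneg _) (by linarith)
    obtain ⟨h5, h6⟩ := abs_le.mp hup
    exact ⟨⟨h1.le, h2⟩, by simp only; linarith, by simp only; linarith⟩
  refine ((measure_mono h).trans_lt ?_).ne
  exact (isCompact_Icc.prod isCompact_Icc).measure_lt_top

theorem integrable_atom (x : Heisenberg) : Integrable (atom x) :=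
  integrable_of_bounded_of_support (measurable_atom x) (norm_atom_le x)
    (volume_atomSupport_ne_top x.p) fun _ => atom_eq_zero

theorem integrable_atom_mul_conj_atom (x y : Heisenberg) :
    Integrable fun z => atom x z * starRingEnd ℂ (atom y z) := by
  refine (integrable_atom x).mul_bdd (c := 1) ?_ ?_
  · exact (RCLike.continuous_conj.measurable.comp (measurable_atom y)).aestronglyMeasurable
  · exact Eventually.of_forall fun z => by
      rw [RCLike.norm_conj]
      exact norm_atom_le y z

/-- Two intervals of length `r` displaced by `w` overlap in a centred interval of length `r - |w|`;
this is where the factor `1 - |p|` in `S` originates. -/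
theorem mem_Ioc_and_mem_Ioc_iff (v w r : ℝ) :
    (v + w / 2 ∈ Set.Ioc (-(r / 2)) (r / 2) ∧ v - w / 2 ∈ Set.Ioc (-(r / 2)) (r / 2)) ↔
      v ∈ Set.Ioc (-((r - |w|) / 2)) ((r - |w|) / 2) := by
  simp only [Set.mem_Ioc]
  rcases abs_cases w with ⟨h, h'⟩ | ⟨h, h'⟩ <;> rw [h] <;> constructor <;>
    intro H <;> (try constructor) <;> (try constructor) <;> linarith [H.1, H.2]

-- Shifting `v` by the mean of the two shears centres the overlap of the supports, and the remaining
-- phase depends only on `x⁻¹ * y`.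
open Classical in
theorem atom_mul_conj_atom_sub (x y : Heisenberg) (u v : ℝ) :
    atom x (u, v - u * (x.p + y.p) / 2) *
        starRingEnd ℂ (atom y (u, v - u * (x.p + y.p) / 2))
      = if u ∈ Set.Ioc (-(1 / 2) : ℝ) (1 / 2) then
          phase (u * (x⁻¹ * y).t) *
            (Set.Ioc (-(|u| * ((1 - |(x⁻¹ * y).p|) / 2)))
              (|u| * ((1 - |(x⁻¹ * y).p|) / 2))).indicator (fun v => phase (v * (x⁻¹ * y).q)) v
        else 0 := by
  by_cases hu : u ∈ Set.Ioc (-(1 / 2) : ℝ) (1 / 2)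
  swap
  · rw [if_neg hu, atom_eq_zero fun h => hu h.1, zero_mul]
  rw [if_pos hu]
  have hiff := mem_Ioc_and_mem_Ioc_iff v (u * (x.p - y.p)) |u|
  have hd : (|u| - |u * (x.p - y.p)|) / 2 = |u| * ((1 - |(x⁻¹ * y).p|) / 2) := by
    rw [abs_mul, p_mul, p_inv, neg_add_eq_sub, abs_sub_comm]
    ring
  rw [hd] at hiff
  have hx : (u, v - u * (x.p + y.p) / 2) ∈ atomSupport x.p ↔
      v + u * (x.p - y.p) / 2 ∈ Set.Ioc (-(|u| / 2)) (|u| / 2) := by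
    have : v - u * (x.p + y.p) / 2 + u * x.p = v + u * (x.p - y.p) / 2 := by ring
    simp only [atomSupport, Set.mem_ofPred_eq, hu, true_and, this]
  have hy : (u, v - u * (x.p + y.p) / 2) ∈ atomSupport y.p ↔
      v - u * (x.p - y.p) / 2 ∈ Set.Ioc (-(|u| / 2)) (|u| / 2) := by
    have : v - u * (x.p + y.p) / 2 + u * y.p = v - u * (x.p - y.p) / 2 := by ring
    simp only [atomSupport, Set.mem_ofPred_eq, hu, true_and, this]
  by_cases hv : v ∈ Set.Ioc (-(|u| * ((1 - |(x⁻¹ * y).p|) / 2)))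
      (|u| * ((1 - |(x⁻¹ * y).p|) / 2))
  · obtain ⟨h1, h2⟩ := hiff.mpr hv
    rw [Set.indicator_of_mem hv, atom, atom, if_pos (hx.mpr h1), if_pos (hy.mpr h2), conj_phase,
      ← phase_add, ← phase_add]
    congr 1
    simp only [t_mul, t_inv, p_inv, q_inv, q_mul]
    ring
  · rw [Set.indicator_of_notMem hv, mul_zero]
    by_cases h1 : (u, v - u * (x.p + y.p) / 2) ∈ atomSupport x.p
    · rw [atom_eq_zero (x := y) fun h2 => hv (hiff.mp ⟨hx.mp h1, hy.mp h2⟩), map_zero, mul_zero]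
    · rw [atom_eq_zero h1, zero_mul]

theorem integral_atom_mul_conj_atom (x y : Heisenberg) :
    ∫ z, atom x z * starRingEnd ℂ (atom y z) = sincType (x⁻¹ * y) := by
  classical
  have hi := integrable_atom_mul_conj_atom x y
  rw [Measure.volume_eq_prod] at hi ⊢
  rw [integral_prod _ hi, sincType, sincTypeReal_eq_integral_phase,
    intervalIntegral.integral_of_le (by norm_num), ← integral_indicator measurableSet_Ioc]
  congr 1 with u
  rw [← integral_sub_right_eq_self _ (u * (x.p + y.p) / 2)]
  simp_rw [atom_mul_conj_atom_sub]
  by_cases hu : u ∈ Set.Ioc (-(1 / 2) : ℝ) (1 / 2)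
  swap
  · simp only [if_neg hu, integral_zero, Set.indicator_of_notMem hu]
  simp_rw [if_pos hu]
  rw [Set.indicator_of_mem hu, integral_const_mul, integral_indicator measurableSet_Ioc]
  congr 1
  -- When the shears differ by at least one the supports do not overlap, matching the cutoff in the
  -- integral formula.
  rcases le_or_gt ((1 - |(x⁻¹ * y).p|) / 2) 0 with h | h
  · rw [max_eq_left h, mul_zero, neg_zero, intervalIntegral.integral_same, Set.Ioc_eq_empty]
    · simp
    · have := mul_nonpos_of_nonneg_of_nonpos (abs_nonneg u) h
      linarith
  · rw [max_eq_right h.le, intervalIntegral.integral_of_le]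
    have := mul_nonneg (abs_nonneg u) h.le
    linarith

/-- The element of the lattice `Γ₁` with index `(m, n, k)`. -/
noncomputable def latticeMk (i : ℤ × ℤ × ℤ) : Heisenberg :=
  mk i.1 i.2.1 (i.2.2 - i.1 * i.2.1 / 2)

theorem conj_atom_latticeMk (m n k : ℤ) (z : ℝ × ℝ) :
    starRingEnd ℂ (atom (latticeMk (m, n, k)) z)
      = (atomSupport m).indicator (fun z => phase (z.1 * k + z.2 * n)) z := by
  by_cases hz : z ∈ atomSupport m
  · rw [Set.indicator_of_mem hz, atom, latticeMk, if_pos (by simpa using hz), conj_phase]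
    congr 1
    simp only [p_mk, q_mk, t_mk]
    ring
  · rw [Set.indicator_of_notMem hz, atom_eq_zero (by simpa [latticeMk] using hz), map_zero]

/-- Over a fixed `u ≠ 0` the fibres are the translates by `-um` of a half-open interval of length
`|u|`, so they partition the line. For `u < 0` the index `m` changes sign. -/
theorem existsUnique_mem_atomSupport {z : ℝ × ℝ} (hz : z.1 ∈ Set.Ioc (-(1 / 2) : ℝ) (1 / 2))
    (h0 : z.1 ≠ 0) : ∃! m : ℤ, z ∈ atomSupport m := by
  have hp : 0 < |z.1| := abs_pos.mpr h0
  obtain ⟨m, hm, hm'⟩ := existsUnique_add_zsmul_mem_Ioc hp z.2 (-(|z.1| / 2))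
  rw [show -(|z.1| / 2) + |z.1| = |z.1| / 2 by ring] at hm hm'
  simp only [zsmul_eq_mul] at hm hm'
  rcases abs_cases z.1 with ⟨h, _⟩ | ⟨h, _⟩
  · refine ⟨m, ⟨hz, ?_⟩, fun k hk => hm' k ?_⟩
    · convert hm using 1
      rw [h]
      ring
    · have := hk.2
      convert this using 1
      rw [h]
      ring
  · refine ⟨-m, ⟨hz, ?_⟩, fun k hk => ?_⟩
    · convert hm using 1
      rw [h]
      push_cast
      ring
    · have h1 := hm' (-k) <| by
        have := hk.2
        convert this using 1
        rw [h]
        push_cast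
        ring
      rw [← h1, neg_neg]

/-- The lattice atoms form a normalised tight frame of `L²` of the strip. -/
theorem tsum_enorm_sq_integral_mul_conj_atom {w : ℝ × ℝ → ℂ} (hw : Measurable w) {C : ℝ}
    (hC : ∀ z, ‖w z‖ ≤ C) (hInt : Integrable w)
    (hsupp : ∀ z, ¬ (z.1 ∈ Set.Ioc (-(1 / 2) : ℝ) (1 / 2) ∧ z.1 ≠ 0) → w z = 0) :
    ∑' i, ‖∫ z, w z * starRingEnd ℂ (atom (latticeMk i) z)‖ₑ ^ 2 = ∫⁻ z, ‖w z‖ₑ ^ 2 := by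
  rw [ENNReal.tsum_prod']
  simp_rw [ENNReal.tsum_prod']
  have hm : ∀ m : ℤ, ∑' n : ℤ, ∑' k : ℤ,
      ‖∫ z, w z * starRingEnd ℂ (atom (latticeMk (m, n, k)) z)‖ₑ ^ 2
        = ∫⁻ z, (atomSupport m).indicator (fun z => ‖w z‖ₑ ^ 2) z := by
    intro m
    have h1 : ∀ n k : ℤ, ∀ z, w z * starRingEnd ℂ (atom (latticeMk (m, n, k)) z)
        = (atomSupport m).indicator w z * phase (z.1 * k + z.2 * n) := by
      intro n k z
      rw [conj_atom_latticeMk]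
      by_cases hz : z ∈ atomSupport m <;> simp [hz]
    have h2 : ∀ z, (atomSupport m).indicator (fun z => ‖w z‖ₑ ^ 2) z
        = ‖(atomSupport m).indicator w z‖ₑ ^ 2 := by
      intro z
      by_cases hz : z ∈ atomSupport m <;> simp [hz]
    simp_rw [h1, h2]
    -- The fibre over `u` is centred at `-um` and has length `|u| ≤ 1/2`, so it lies in the unit
    -- interval with that centre.
    refine tsum_enorm_sq_integral_mul_phase_prod (a := -(1 / 2))
      (c := fun u => -u * m - 1 / 2) (C := C)
      (hw.indicator (measurableSet_atomSupport _)) (fun z => ?_)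
      (hInt.indicator (measurableSet_atomSupport _)) (fun z hz => ?_) fun z hz => ?_
    · exact (norm_indicator_le_norm_self _ _).trans (hC z)
    · refine Set.indicator_of_notMem (fun h => hz ?_) _
      convert h.1 using 2
      norm_num
    · refine Set.indicator_of_notMem (fun h => hz ?_) _
      obtain ⟨⟨h1, h2⟩, h3, h4⟩ := h
      have h5 : |z.1| ≤ 1 / 2 := abs_le.mpr ⟨h1.le, h2⟩
      constructor <;> linarith
  simp_rw [hm]
  rw [← lintegral_tsum fun m => ((hw.enorm.pow_const 2).indicator
    (measurableSet_atomSupport _)).aemeasurable]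
  refine lintegral_congr fun z => ?_
  by_cases hz : z.1 ∈ Set.Ioc (-(1 / 2) : ℝ) (1 / 2) ∧ z.1 ≠ 0
  -- By the tiling exactly one indicator survives in the sum over `m`.
  · obtain ⟨m, hm, hm'⟩ := existsUnique_mem_atomSupport hz.1 hz.2
    rw [tsum_eq_single m fun k hk => Set.indicator_of_notMem (fun h => hk (hm' k h)) _,
      Set.indicator_of_mem hm]
  · have h0 : ∀ m : ℤ, (atomSupport m).indicator (fun z => ‖w z‖ₑ ^ 2) z = 0 := fun m => by
      simp [hsupp z hz]
    simp [h0, hsupp z hz]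

theorem atom_eq_zero_of_fst {x : Heisenberg} {z : ℝ × ℝ}
    (hz : ¬ (z.1 ∈ Set.Ioc (-(1 / 2) : ℝ) (1 / 2) ∧ z.1 ≠ 0)) : atom x z = 0 := by
  refine atom_eq_zero fun h => hz ⟨h.1, fun h0 => ?_⟩
  have h2 := h.2
  rw [h0] at h2
  simp at h2

/-- Hermitian symmetry of the inner product of atoms, combined with `S` being real. -/
theorem sincType_inv_mul_comm (x y : Heisenberg) : sincType (y⁻¹ * x) = sincType (x⁻¹ * y) := by
  have h := integral_atom_mul_conj_atom x y
  have h' := integral_conj (μ := volume) (f := fun z => atom x z * starRingEnd ℂ (atom y z))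
  simp only [map_mul, Complex.conj_conj] at h'
  simp_rw [mul_comm (starRingEnd ℂ (atom x _))] at h'
  rw [integral_atom_mul_conj_atom, h] at h'
  rw [h', sincType, Complex.conj_ofReal]

/-- The diagonal terms are `S(1) = 1/4` each, and by symmetry the two cross terms coincide. -/
theorem integrable_and_integral_norm_sq_atom_add_atom (x y : Heisenberg) :
    Integrable (fun z => ‖atom x z + atom y z‖ ^ 2) ∧ ∫ z, ‖atom x z + atom y z‖ ^ 2
      = 1 / 2 + 2 * sincTypeReal (x⁻¹ * y).p (x⁻¹ * y).q (x⁻¹ * y).t := by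
  have hexp : ∀ z, ((‖atom x z + atom y z‖ ^ 2 : ℝ) : ℂ)
      = atom x z * starRingEnd ℂ (atom x z) + atom x z * starRingEnd ℂ (atom y z)
        + (atom y z * starRingEnd ℂ (atom x z) + atom y z * starRingEnd ℂ (atom y z)) := by
    intro z
    rw [Complex.ofReal_pow, ← Complex.mul_conj', map_add]
    ring
  have hxy : Integrable fun z => atom x z * starRingEnd ℂ (atom x z)
      + atom x z * starRingEnd ℂ (atom y z) :=
    (integrable_atom_mul_conj_atom x x).add (integrable_atom_mul_conj_atom x y)
  have hyx : Integrable fun z => atom y z * starRingEnd ℂ (atom x z)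
      + atom y z * starRingEnd ℂ (atom y z) :=
    (integrable_atom_mul_conj_atom y x).add (integrable_atom_mul_conj_atom y y)
  constructor
  · have : Integrable fun z => ((‖atom x z + atom y z‖ ^ 2 : ℝ) : ℂ) := by
      simp_rw [hexp]
      exact hxy.add hyx
    exact this.re
  · apply Complex.ofReal_injective
    rw [← integral_complex_ofReal]
    simp_rw [hexp]
    rw [integral_add hxy hyx, integral_add (integrable_atom_mul_conj_atom x x)
      (integrable_atom_mul_conj_atom x y), integral_add (integrable_atom_mul_conj_atom y x)
      (integrable_atom_mul_conj_atom y y)]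
    simp_rw [integral_atom_mul_conj_atom]
    rw [inv_mul_cancel, inv_mul_cancel, sincType_inv_mul_comm x y, sincType_one, sincType]
    push_cast
    ring

theorem nonneg_half_add_two_mul_sincTypeReal (x y : Heisenberg) :
    0 ≤ 1 / 2 + 2 * sincTypeReal (x⁻¹ * y).p (x⁻¹ * y).q (x⁻¹ * y).t := by
  rw [← (integrable_and_integral_norm_sq_atom_add_atom x y).2]
  positivity

/-- Parseval's identity for sums of two translates of `S`. -/
theorem tsum_enorm_sq_sincType_add_sincType (x y : Heisenberg) :
    ∑' i, ‖sincType (x⁻¹ * latticeMk i) + sincType (y⁻¹ * latticeMk i)‖ₑ ^ 2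
      = ENNReal.ofReal (1 / 2 + 2 * sincTypeReal (x⁻¹ * y).p (x⁻¹ * y).q (x⁻¹ * y).t) := by
  have hw := tsum_enorm_sq_integral_mul_conj_atom (w := fun z => atom x z + atom y z) (C := 2)
    ((measurable_atom x).add (measurable_atom y))
    (fun z => (norm_add_le _ _).trans (by linarith [norm_atom_le x z, norm_atom_le y z]))
    ((integrable_atom x).add (integrable_atom y))
    (fun z hz => by rw [atom_eq_zero_of_fst hz, atom_eq_zero_of_fst hz, add_zero])
  simp_rw [add_mul] at hw
  simp_rw [integral_add (integrable_atom_mul_conj_atom x _) (integrable_atom_mul_conj_atom y _),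
    integral_atom_mul_conj_atom] at hw
  obtain ⟨hI, hInt⟩ := integrable_and_integral_norm_sq_atom_add_atom x y
  rw [hw, ← hInt, ofReal_integral_eq_lintegral_ofReal hI
    (Eventually.of_forall fun _ => by positivity)]
  refine lintegral_congr fun z => ?_
  rw [ENNReal.ofReal_pow (norm_nonneg _), ofReal_norm]

end Heisenberg

/-! ### Polarisation, the lattice, and transfer to the group. -/

namespace Heisenberg

open scoped ENNReal

theorem hasSum_sq_sincTypeReal_add (x y : Heisenberg) :
    HasSum (fun i => (sincTypeReal (x⁻¹ * latticeMk i).p (x⁻¹ * latticeMk i).q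
        (x⁻¹ * latticeMk i).t + sincTypeReal (y⁻¹ * latticeMk i).p (y⁻¹ * latticeMk i).q
        (y⁻¹ * latticeMk i).t) ^ 2)
      (1 / 2 + 2 * sincTypeReal (x⁻¹ * y).p (x⁻¹ * y).q (x⁻¹ * y).t) := by
  have h := tsum_enorm_sq_sincType_add_sincType x y
  have hs := ENNReal.hasSum_toReal (h.trans_ne ENNReal.ofReal_ne_top)
  rw [← ENNReal.tsum_toReal_eq fun i => by finiteness, h,
    ENNReal.toReal_ofReal (nonneg_half_add_two_mul_sincTypeReal x y)] at hs
  convert hs using 2 with i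
  rw [ENNReal.toReal_pow, toReal_enorm, sincType, sincType, ← Complex.ofReal_add,
    Complex.norm_real, Real.norm_eq_abs, sq_abs]

theorem hasSum_sincType_mul_sincType (x y : Heisenberg) :
    HasSum (fun i => sincType ((latticeMk i)⁻¹ * x) * sincType (y⁻¹ * latticeMk i))
      (sincType (y⁻¹ * x)) := by
  have hsq : ∀ x : Heisenberg, HasSum (fun i => sincTypeReal (x⁻¹ * latticeMk i).p
      (x⁻¹ * latticeMk i).q (x⁻¹ * latticeMk i).t ^ 2) (1 / 4) := by
    intro x
    have h := (hasSum_sq_sincTypeReal_add x x).div_const 4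
    rw [inv_mul_cancel, p_one, q_one, t_one, sincTypeReal_zero] at h
    have h1 : ∀ a : ℝ, (a + a) ^ 2 / 4 = a ^ 2 := fun a => by ring
    rw [show (1 / 2 + 2 * (1 / 4)) / 4 = (1 / 4 : ℝ) by norm_num] at h
    simpa only [h1] using h
  -- Real polarisation `ab = ((a + b)² - a² - b²) / 2` suffices since `S` is real-valued.
  have h := (((hasSum_sq_sincTypeReal_add x y).sub (hsq x)).sub (hsq y)).div_const 2
  have h2 := Complex.hasSum_ofReal.mpr h
  convert h2 using 2 with i
  · rw [sincType_inv_mul_comm x, sincType, sincType, ← Complex.ofReal_mul]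
    congr 1
    ring
  · rw [sincType_inv_mul_comm x, sincType]
    congr 1
    ring

/-! ### The lattice -/

theorem latticeMk_mul (i j : ℤ × ℤ × ℤ) :
    latticeMk i * latticeMk j
      = latticeMk (i.1 + j.1, i.2.1 + j.2.1, i.2.2 + j.2.2 + i.1 * j.2.1) := by
  apply ext_coord <;> simp [latticeMk]
  ring

theorem latticeMk_inv (i : ℤ × ℤ × ℤ) :
    (latticeMk i)⁻¹ = latticeMk (-i.1, -i.2.1, -i.2.2 + i.1 * i.2.1) := by
  apply ext_coord <;> simp [latticeMk]
  ring

theorem mem_lattice_one_iff (x : Heisenberg) :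
    x ∈ lattice 1 ↔ x ∈ Set.range latticeMk := by
  constructor
  · intro hx
    induction hx using Subgroup.closure_induction with
    | mem x hx =>
      rcases hx with rfl | rfl | rfl
      · exact ⟨(1, 0, 0), by apply ext_coord <;> simp [latticeMk]⟩
      · exact ⟨(0, 1, 0), by apply ext_coord <;> simp [latticeMk]⟩
      · exact ⟨(0, 0, 1), by apply ext_coord <;> simp [latticeMk]⟩
    | one => exact ⟨0, by apply ext_coord <;> simp [latticeMk]⟩
    | mul x y _ _ hx hy =>
      obtain ⟨i, rfl⟩ := hx
      obtain ⟨j, rfl⟩ := hy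
      exact ⟨_, (latticeMk_mul i j).symm⟩
    | inv x _ hx =>
      obtain ⟨i, rfl⟩ := hx
      exact ⟨_, (latticeMk_inv i).symm⟩
  · rintro ⟨⟨m, n, k⟩, rfl⟩
    have hP : ∀ m : ℤ, mk m 0 0 ∈ lattice 1 := by
      let φ : Multiplicative ℤ →* Heisenberg := MonoidHom.mk' (fun m => mk m.toAdd 0 0)
        fun a b => by apply ext_coord <;> simp
      intro m
      have : φ (Multiplicative.ofAdd 1 ^ m) ∈ lattice 1 := by
        rw [map_zpow]
        exact zpow_mem (Subgroup.subset_closure (by simp [φ])) _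
      simpa [φ] using this
    have hQ : ∀ n : ℤ, mk 0 n 0 ∈ lattice 1 := by
      let φ : Multiplicative ℤ →* Heisenberg := MonoidHom.mk' (fun m => mk 0 m.toAdd 0)
        fun a b => by apply ext_coord <;> simp
      intro m
      have : φ (Multiplicative.ofAdd 1 ^ m) ∈ lattice 1 := by
        rw [map_zpow]
        exact zpow_mem (Subgroup.subset_closure (by simp [φ])) _
      simpa [φ] using this
    have hZ : ∀ k : ℤ, mk 0 0 k ∈ lattice 1 := by
      let φ : Multiplicative ℤ →* Heisenberg := MonoidHom.mk' (fun m => mk 0 0 m.toAdd)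
        fun a b => by apply ext_coord <;> simp
      intro m
      have : φ (Multiplicative.ofAdd 1 ^ m) ∈ lattice 1 := by
        rw [map_zpow]
        exact zpow_mem (Subgroup.subset_closure (by simp [φ])) _
      simpa [φ] using this
    -- The product of the first two factors has central coordinate `mn/2`, while the target has `k -
    -- mn/2`.
    have h := mul_mem (mul_mem (hP m) (hQ n)) (hZ (k - m * n))
    convert h using 1
    apply ext_coord <;> simp [latticeMk]
    ring

theorem latticeMk_injective : Function.Injective latticeMk := by
  rintro ⟨m, n, k⟩ ⟨m', n', k'⟩ h
  have hp := congrArg p h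
  have hq := congrArg q h
  have ht := congrArg t h
  simp only [latticeMk, p_mk, q_mk, t_mk, Int.cast_inj] at hp hq ht
  subst hp hq
  simpa using ht

/-- The lattice `Γ₁` is parametrised by `ℤ³`. -/
noncomputable def latticeEquiv : ℤ × ℤ × ℤ ≃ (lattice 1 : Set Heisenberg) :=
  (Equiv.ofInjective latticeMk latticeMk_injective).trans
    (Equiv.setCongr (Set.ext fun x => (mem_lattice_one_iff x).symm))

theorem hasSum_lattice_sincType_mul_sincType (x y : Heisenberg) :
    HasSum (fun γ : (lattice 1 : Set Heisenberg) =>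
      sincType ((γ : Heisenberg)⁻¹ * x) * sincType (y⁻¹ * γ)) (sincType (y⁻¹ * x)) :=
  latticeEquiv.hasSum_iff.mp (hasSum_sincType_mul_sincType x y)

/-! ### Integration over a fundamental domain -/

theorem measurePreserving_inv :
    MeasurePreserving (fun x : Heisenberg => x⁻¹) volume volume :=
  have h := Measure.measurePreserving_neg (volume : Measure ℝ)
  h.prod (h.prod h)

/-- Inversion preserves Lebesgue measure and conjugates right translations into left ones, so the
group is unimodular. -/
theorem measurePreserving_mul_const (y : Heisenberg) :
    MeasurePreserving (fun x : Heisenberg => x * y) volume volume := by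
  have h := measurePreserving_inv.comp
    ((measurePreserving_mul y⁻¹).comp measurePreserving_inv)
  convert h using 1
  ext x
  simp

/-- The index of the lattice translate of the unit cube containing a given point. -/
noncomputable def cubeIndex (x : Heisenberg) : ℤ × ℤ × ℤ :=
  (⌊x.p⌋, ⌊x.q⌋, ⌊x.t + (⌊x.p⌋ * ⌊x.q⌋ : ℝ) / 2 + (x.q * ⌊x.p⌋ - x.p * ⌊x.q⌋) / 2⌋)

/-- The unit cube, a fundamental domain of `Γ₁`. -/
def unitCube : Set Heisenberg :=
  Set.Ico (0 : ℝ) 1 ×ˢ Set.Ico (0 : ℝ) 1 ×ˢ Set.Ico (0 : ℝ) 1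

theorem measurableSet_unitCube : MeasurableSet unitCube :=
  MeasurableSet.prod (α := ℝ) (β := ℝ × ℝ) measurableSet_Ico
    (MeasurableSet.prod measurableSet_Ico measurableSet_Ico)

theorem volume_unitCube : volume unitCube = 1 := by
  change (volume : Measure (ℝ × ℝ × ℝ)) (Set.Ico (0 : ℝ) 1 ×ˢ Set.Ico (0 : ℝ) 1 ×ˢ
    Set.Ico (0 : ℝ) 1) = 1
  simp [Measure.volume_eq_prod, Measure.prod_prod]

theorem mem_unitCube_iff (x : Heisenberg) :
    x ∈ unitCube ↔ ⌊x.p⌋ = 0 ∧ ⌊x.q⌋ = 0 ∧ ⌊x.t⌋ = 0 := by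
  simp only [Int.floor_eq_zero_iff]
  rfl

/-- The right lattice translates of the unit cube are the level sets of `cubeIndex`, hence they
partition the group. Once the floors of `x.p` and `x.q` vanish, the twist terms cancel and leave the
floor of `x.t + k`. -/
theorem cubeIndex_mul_latticeMk (x : Heisenberg) (i : ℤ × ℤ × ℤ) :
    cubeIndex (x * latticeMk i) = i ↔ x ∈ unitCube := by
  obtain ⟨m, n, k⟩ := i
  have hp : ⌊(x * latticeMk (m, n, k)).p⌋ = ⌊x.p⌋ + m := by simp [latticeMk]
  have hq : ⌊(x * latticeMk (m, n, k)).q⌋ = ⌊x.q⌋ + n := by simp [latticeMk]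
  rw [mem_unitCube_iff, cubeIndex, hp, hq]
  simp only [Prod.mk.injEq, add_eq_right]
  refine and_congr_right fun h1 => and_congr_right fun h2 => ?_
  have : (x * latticeMk (m, n, k)).t + (((⌊x.p⌋ + m : ℤ) : ℝ) * ((⌊x.q⌋ + n : ℤ) : ℝ)) / 2
      + ((x * latticeMk (m, n, k)).q * ((⌊x.p⌋ + m : ℤ) : ℝ)
        - (x * latticeMk (m, n, k)).p * ((⌊x.q⌋ + n : ℤ) : ℝ)) / 2 = x.t + k := by
    simp only [h1, h2, zero_add, latticeMk, p_mul, q_mul, t_mul, p_mk, q_mk, t_mk]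
    ring
  rw [this, Int.floor_add_intCast, add_eq_right]

theorem measurable_cubeIndex : Measurable cubeIndex := by
  have hp : Measurable p := continuous_p.measurable
  have hq : Measurable q := continuous_q.measurable
  have ht : Measurable t := continuous_t.measurable
  have hc : Measurable fun n : ℤ => (n : ℝ) := measurable_from_top
  have hp' : Measurable fun x : Heisenberg => ((⌊x.p⌋ : ℤ) : ℝ) := hc.comp hp.floor
  have hq' : Measurable fun x : Heisenberg => ((⌊x.q⌋ : ℤ) : ℝ) := hc.comp hq.floor
  exact hp.floor.prodMk (hq.floor.prodMk (Measurable.floor (by fun_prop)))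

theorem lintegral_eq_setLIntegral_unitCube_tsum {g : Heisenberg → ℝ≥0∞} (hg : Measurable g) :
    ∫⁻ x, g x = ∫⁻ x in unitCube, ∑' i, g (x * latticeMk i) := by
  have hm : ∀ i, MeasurableSet (cubeIndex ⁻¹' {i}) := fun i =>
    measurable_cubeIndex (measurableSet_singleton i)
  have h1 : ∀ x, g x = ∑' i, (cubeIndex ⁻¹' {i}).indicator g x := fun x => by
    have hx : x ∈ cubeIndex ⁻¹' {cubeIndex x} := rfl
    rw [tsum_eq_single (cubeIndex x), Set.indicator_of_mem hx]
    intro i hi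
    exact Set.indicator_of_notMem (s := cubeIndex ⁻¹' {i}) (fun h => hi (Eq.symm h)) g
  have h2 : ∀ i, ∫⁻ x, (cubeIndex ⁻¹' {i}).indicator g x
      = ∫⁻ x in unitCube, g (x * latticeMk i) := fun i => by
    rw [← (measurePreserving_mul_const (latticeMk i)).lintegral_comp (hg.indicator (hm i)),
      ← lintegral_indicator measurableSet_unitCube]
    refine lintegral_congr fun x => ?_
    have : x * latticeMk i ∈ cubeIndex ⁻¹' {i} ↔ x ∈ unitCube := cubeIndex_mul_latticeMk x i
    by_cases hx : x ∈ unitCube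
    · rw [Set.indicator_of_mem hx, Set.indicator_of_mem (this.mpr hx)]
    · rw [Set.indicator_of_notMem hx, Set.indicator_of_notMem fun h => hx (this.mp h)]
  simp_rw [h1]
  rw [lintegral_tsum fun i => (hg.indicator (hm i)).aemeasurable]
  simp_rw [h2, ← h1]
  exact (lintegral_tsum fun i =>
    (hg.comp (measurePreserving_mul_const (latticeMk i)).measurable).aemeasurable).symm

/-! ### The reproducing property -/

theorem lintegral_enorm_sq_sincType_add_sincType (x y : Heisenberg) :
    ∫⁻ z, ‖sincType (x⁻¹ * z) + sincType (y⁻¹ * z)‖ₑ ^ 2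
      = ENNReal.ofReal (1 / 2 + 2 * sincTypeReal (x⁻¹ * y).p (x⁻¹ * y).q (x⁻¹ * y).t) := by
  have hS := continuous_sincType
  have hm : Measurable fun z : Heisenberg => ‖sincType (x⁻¹ * z) + sincType (y⁻¹ * z)‖ₑ ^ 2 :=
    Continuous.measurable (by fun_prop)
  rw [lintegral_eq_setLIntegral_unitCube_tsum hm]
  have h : ∀ z, ∑' i, ‖sincType (x⁻¹ * (z * latticeMk i)) + sincType (y⁻¹ * (z * latticeMk i))‖ₑ ^ 2
      = ENNReal.ofReal (1 / 2 + 2 * sincTypeReal (x⁻¹ * y).p (x⁻¹ * y).q (x⁻¹ * y).t) := by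
    intro z
    -- The value of the lattice sum depends only on `x⁻¹ * y`, which is unchanged when both points
    -- are moved by `z⁻¹`; so the integrand is constant on the cube.
    have := tsum_enorm_sq_sincType_add_sincType (z⁻¹ * x) (z⁻¹ * y)
    simpa only [mul_inv_rev, inv_inv, mul_assoc, mul_inv_cancel_left] using this
  simp_rw [h]
  rw [setLIntegral_const, volume_unitCube, mul_one]

theorem memLp_sincType : MemLp sincType 2 (volume : Measure Heisenberg) := by
  -- The case `x = y = 1` of the norm identity gives square integrability of `2S`.
  have h : MemLp (fun z => sincType z + sincType z) 2 (volume : Measure Heisenberg) := by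
    refine ⟨(continuous_sincType.add continuous_sincType).aestronglyMeasurable, ?_⟩
    rw [eLpNorm_lt_top_iff_lintegral_rpow_enorm_lt_top (by norm_num) (by norm_num)]
    have := lintegral_enorm_sq_sincType_add_sincType 1 1
    simp only [inv_one, one_mul] at this
    simp only [ENNReal.toReal_ofNat, ENNReal.rpow_ofNat, this]
    exact ENNReal.ofReal_lt_top
  have h' := h.const_mul (1 / 2)
  convert h' using 2
  ring

theorem norm_sq_leftRegular_add (x y : Heisenberg) :
    ‖leftRegular volume x (memLp_sincType.toLp sincType)
      + leftRegular volume y (memLp_sincType.toLp sincType)‖ ^ 2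
      = 1 / 2 + 2 * sincTypeReal (x⁻¹ * y).p (x⁻¹ * y).q (x⁻¹ * y).t := by
  rw [Lp.norm_def, ← ENNReal.toReal_pow,
    ← ENNReal.toReal_ofReal (nonneg_half_add_two_mul_sincTypeReal x y),
    ← lintegral_enorm_sq_sincType_add_sincType]
  congr 1
  rw [eLpNorm_eq_lintegral_rpow_enorm_toReal (by norm_num) (by norm_num), ← ENNReal.rpow_natCast,
    ← ENNReal.rpow_mul, show 1 / ENNReal.toReal 2 * ((2 : ℕ) : ℝ) = 1 by norm_num,
    ENNReal.rpow_one]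
  simp only [ENNReal.toReal_ofNat, ENNReal.rpow_ofNat]
  refine lintegral_congr_ae ?_
  filter_upwards [Lp.coeFn_add (leftRegular volume x (memLp_sincType.toLp sincType))
    (leftRegular volume y (memLp_sincType.toLp sincType)),
    coeFn_leftRegular_toLp memLp_sincType x, coeFn_leftRegular_toLp memLp_sincType y]
    with z h1 h2 h3
  rw [h1, Pi.add_apply, h2, h3]

theorem norm_leftRegular_sincType (x : Heisenberg) :
    ‖leftRegular volume x (memLp_sincType.toLp sincType)‖ = 1 / 2 := by
  have h := norm_sq_leftRegular_add x x
  rw [inv_mul_cancel, p_one, q_one, t_one, sincTypeReal_zero, ← two_smul ℝ, norm_smul, mul_pow] at h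
  norm_num at h
  rw [← sq_eq_sq₀ (norm_nonneg _) (by norm_num)]
  linarith

theorem inner_leftRegular_sincType (x y : Heisenberg) :
    inner ℂ (leftRegular volume x (memLp_sincType.toLp sincType))
      (leftRegular volume y (memLp_sincType.toLp sincType)) = sincType (y⁻¹ * x) := by
  -- The norm of a sum determines only the real part of the inner product; both functions being real
  -- removes the imaginary part.
  have him : ∃ r : ℝ, inner ℂ (leftRegular volume x (memLp_sincType.toLp sincType))
      (leftRegular volume y (memLp_sincType.toLp sincType)) = (r : ℂ) := by
    refine ⟨∫ z, sincTypeReal (y⁻¹ * z).p (y⁻¹ * z).q (y⁻¹ * z).t *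
      sincTypeReal (x⁻¹ * z).p (x⁻¹ * z).q (x⁻¹ * z).t, ?_⟩
    rw [L2.inner_def, ← integral_complex_ofReal]
    refine integral_congr_ae ?_
    filter_upwards [coeFn_leftRegular_toLp memLp_sincType x,
      coeFn_leftRegular_toLp memLp_sincType y] with z h2 h3
    rw [h2, h3, sincType, sincType, RCLike.inner_apply, Complex.conj_ofReal, Complex.ofReal_mul]
  obtain ⟨r, hr⟩ := him
  have h := norm_add_sq (𝕜 := ℂ) (leftRegular volume x (memLp_sincType.toLp sincType))
    (leftRegular volume y (memLp_sincType.toLp sincType))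
  rw [norm_sq_leftRegular_add, norm_leftRegular_sincType, norm_leftRegular_sincType, hr] at h
  rw [hr, sincType_inv_mul_comm, sincType]
  simp only [RCLike.re_to_complex, Complex.ofReal_re] at h
  congr 1
  linarith

end Heisenberg

/-! ### Assembly of the theorem. -/

theorem theorem8p1 :
    ∃ hS : MemLp Heisenberg.sincType 2 (volume : Measure Heisenberg),
      let S : Lp ℂ 2 (volume : Measure Heisenberg) := hS.toLp Heisenberg.sincType
      let H : Submodule ℂ (Lp ℂ 2 (volume : Measure Heisenberg)) :=
        leftInvariantClosedSpan volume S
      let Γ₁ : Set Heisenberg := (Heisenberg.lattice 1 : Set Heisenberg)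
      IsSamplingSpace volume Γ₁ H ∧
      IsSamplingConstant volume Γ₁ H 1 ∧
      IsSincTypeFunction volume Γ₁ H Heisenberg.sincType ∧
      IsTightFrameOf H (fun γ : Γ₁ => leftRegular volume (γ : Heisenberg) S) 1 ∧
      ¬ IsOrthonormalBasisOf H (fun γ : Γ₁ => leftRegular volume (γ : Heisenberg) S) ∧
      ‖S‖ = 1 / 2 := by
  have hc := Heisenberg.continuous_sincType
  have hrep := Heisenberg.inner_leftRegular_sincType
  have hframe := Heisenberg.hasSum_lattice_sincType_mul_sincType
  refine ⟨Heisenberg.memLp_sincType, isSamplingSpace_of_reproducing hc hrep hframe,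
    isSamplingConstant_of_reproducing hc hrep hframe,
    isSincTypeFunction_of_reproducing hc hrep hframe,
    isTightFrameOf_of_reproducing hrep hframe, ?_, ?_⟩
  -- Basis vectors would have norm one, but every translate of `S` has norm `1/2`.
  · rintro ⟨b, hb⟩
    have h1 : ‖(b ⟨1, one_mem _⟩ : Lp ℂ 2 (volume : Measure Heisenberg))‖ = 1 :=
      b.orthonormal.1 _
    rw [hb, Heisenberg.norm_leftRegular_sincType] at h1
    norm_num at h1
  · rw [← leftRegular_one (Heisenberg.memLp_sincType.toLp Heisenberg.sincType)]
    exact Heisenberg.norm_leftRegular_sincType 1
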